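/- All graphs are finite, simple and undirected. For graphs $H$ and $G$, we say that $G$ contains an induced $H$ if some induced subgraph of $G$ is isomorphic to $H$; $G$ is $\{C_3,C_4\}$-free if it contains neither an induced cycle $C_3$ of order $3$ nor an induced cycle $C_4$ of order $4$. Let $T_n$ be the tree obtained from a path $u_1u_2\cdots u_n$ of order $n$ by adding two vertices $v_3,v_3'$ and the edges $u_3v_3,\ v_3v_3'$. Let $T_8^{(1)}$ be the tree (of order $12$) obtained from $T_8$ by adding two vertices $w_5,w_6$ and the edges $u_5w_5,\ u_6w_6$, and let $T_8^{(2)}$ be the tree (of order $11$) obtained from $T_8$ by adding one vertex $w_4$ and the edge $u_4w_4$. Theorem. Let $G$ be a connected $\{C_3,C_4\}$-free graph with minimum degree $\delta(G)\ge 3$, and let $\Delta(G)$ denote its maximum degree. Then the following hold. (i) If $\Delta(G)\ge 943218$, then $G$ contains an induced $T_8^{(1)}$. (ii) If $\Delta(G)\ge 190375$, then $G$ contains an induced $T_8^{(2)}$. (iii) If $\Delta(G)\ge 197433$, then $G$ contains an induced $T_9$. -/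

import Mathlib

/-- The tree `T₈⁽¹⁾` on twelve vertices.  Vertices `0, …, 7` form the path `u₁ u₂ ⋯ u₈`
(so `u₃` is `2`, `u₅` is `4`, `u₆` is `5`); a path `8, 9` with two vertices is attached at `u₃`,
and one pendant vertex is attached at each of `u₅` and `u₆`. -/
def treeT81 : SimpleGraph (Fin 12) :=
  SimpleGraph.fromEdgeSet
    {s(0, 1), s(1, 2), s(2, 3), s(3, 4), s(4, 5), s(5, 6), s(6, 7),
     s(2, 8), s(8, 9), s(4, 10), s(5, 11)}

/-- The tree `T₈⁽²⁾` on eleven vertices.  Vertices `0, …, 7` form the path `u₁ u₂ ⋯ u₈`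
(so `u₃` is `2`, `u₄` is `3`); a path `8, 9` with two vertices is attached at `u₃`,
and one pendant vertex is attached at `u₄`. -/
def treeT82 : SimpleGraph (Fin 11) :=
  SimpleGraph.fromEdgeSet
    {s(0, 1), s(1, 2), s(2, 3), s(3, 4), s(4, 5), s(5, 6), s(6, 7),
     s(2, 8), s(8, 9), s(3, 10)}

/-- The tree `T₉` on eleven vertices.  Vertices `0, …, 8` form the path `u₁ u₂ ⋯ u₉`
(so `u₃` is `2`); a path `9, 10` with two vertices is attached at `u₃`. -/
def treeT9 : SimpleGraph (Fin 11) :=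
  SimpleGraph.fromEdgeSet
    {s(0, 1), s(1, 2), s(2, 3), s(3, 4), s(4, 5), s(5, 6), s(6, 7), s(7, 8),
     s(2, 9), s(9, 10)}

/-! Look at `G` from a vertex `x` of maximum degree. Every neighbour `y` of `x` has at least two
children (further neighbours, at distance two from `x`), and a vertex at distance two has only one
parent. Since the girth is at least five, a map of one of the trees is induced once vertices at tree
distance two have distinct images and chords at tree distance four or more are absent
(`Sparse.isIndContained_of_far`).

If more than 224 neighbours of `x` are joined, each through two of its children, to the same two
vertices `p`, `q`, this theta structure already contains all three trees (`Theta.isIndContained`).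
Otherwise a few far vertices spoil only few neighbours of `x`, so any six far vertices are avoided
by two legs of length two hanging at `x` (`Sparse.exists_legs`). With `x` as `u₃` these legs are one
end of the tree. Hence if the tree is missing, the remaining part, a stem through another neighbour
`y` of `x`, never occurs without a chord (`NoStemOne`, `NoStemTwo`, `NoStemNine`).

Such a rule is rigid: it forces every vertex one or two steps beyond a child to have at most four
far neighbours (`Tame`). A bounded local structure at `y` then touches those of boundedly many other
neighbours of `x`, so three pairwise non-adjacent ones exist, and they contain the missing tree
(`Tame.isIndContained`). Degree 8074 suffices for all three trees. -/

namespace SimpleGraph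

/-! ### Recognising induced trees in graphs of girth at least five -/

variable {V : Type*} {G : SimpleGraph V}

/-- Girth at least five and minimum degree at least three, in elementary form. -/
structure Sparse (G : SimpleGraph V) : Prop where
  tri : ∀ {a b c}, G.Adj a b → G.Adj b c → ¬ G.Adj a c
  sq : ∀ {a b c d}, G.Adj a b → G.Adj b c → G.Adj c d → a ≠ c → b ≠ d → ¬ G.Adj a d
  third : ∀ v a b, ∃ c, G.Adj v c ∧ c ≠ a ∧ c ≠ b

/-- Injectivity comes for free: two vertices with the same image have the same neighbours in `T`,
and `T` has no twins. -/
theorem isIndContained_of_map {n : ℕ} {T : SimpleGraph (Fin n)} (φ : Fin n → V)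
    (twin : ∀ i j, (∀ k, T.Adj i k ↔ T.Adj j k) → i = j)
    (h : ∀ i j, i < j → (T.Adj i j ↔ G.Adj (φ i) (φ j))) : T.IsIndContained G := by
  have h' : ∀ i j, T.Adj i j ↔ G.Adj (φ i) (φ j) := by
    intro i j
    rcases lt_trichotomy i j with hij | rfl | hij
    · exact h i j hij
    · simp
    · rw [T.adj_comm, G.adj_comm]; exact h j i hij
  refine ⟨⟨⟨φ, fun i j hij => twin i j fun k => ?_⟩, ?_⟩⟩
  · rw [h', h', hij]
  · intro i j; exact (h' i j).symm

/-- In a graph of girth at least five, a locally injective homomorphic image of a twin-free tree is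
induced as soon as vertices at distance at least four (the pairs listed in `far`) are not adjacent.
-/
theorem Sparse.isIndContained_of_far (hG : G.Sparse) {n : ℕ} {T : SimpleGraph (Fin n)}
    (A : Fin n → Fin n → Bool) (hA : ∀ i j, T.Adj i j ↔ A i j = true) (edges sibs far : List (Fin n × Fin n))
    (φ : Fin n → V) (twin : ∀ i j, (∀ k, A i k = A j k) → i = j)
    (far_spec : ∀ i j, i < j → (A i j = true ∧ (i, j) ∉ far) ∨
      (∃ k, A i k = true ∧ A k j = true ∧ A i j = false) ∨
      (∃ k l, A i k = true ∧ A k l = true ∧ A l j = true ∧ i ≠ l ∧ k ≠ j ∧ A i j = false) ∨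
      ((i, j) ∈ far ∧ A i j = false))
    (edges_spec : ∀ i j, i < j → A i j = true → (i, j) ∈ edges)
    (sibs_spec : ∀ i k j, i < j → A i k = true → A k j = true → (i, j) ∈ sibs)
    (edge : ∀ p ∈ edges, G.Adj (φ p.1) (φ p.2)) (inj : ∀ p ∈ sibs, φ p.1 ≠ φ p.2)
    (hfar : ∀ p ∈ far, ¬ G.Adj (φ p.1) (φ p.2)) : T.IsIndContained G := by
  have symmA : ∀ i j, A i j = true → A j i = true := fun i j h => by
    rw [← hA] at h ⊢; exact h.symm
  have irrA : ∀ i, A i i ≠ true := fun i h => by rw [← hA] at h; exact h.ne rfl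
  have edge' : ∀ i j, A i j = true → G.Adj (φ i) (φ j) := by
    intro i j h
    rcases lt_trichotomy i j with hij | rfl | hij
    · exact edge _ (edges_spec i j hij h)
    · exact absurd h (irrA i)
    · exact (edge _ (edges_spec j i hij (symmA _ _ h))).symm
  have inj' : ∀ i k j, i ≠ j → A i k = true → A k j = true → φ i ≠ φ j := by
    intro i k j hne h1 h2
    rcases lt_or_gt_of_ne hne with hij | hij
    · exact inj _ (sibs_spec i k j hij h1 h2)
    · exact (inj _ (sibs_spec j k i hij (symmA _ _ h2) (symmA _ _ h1))).symm
  refine isIndContained_of_map φ (fun i j h => twin i j fun k => ?_) fun i j hij => ?_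
  · have := h k
    rw [hA, hA] at this
    exact Bool.eq_iff_iff.2 this
  · rw [hA]
    rcases far_spec i j hij with ⟨h, -⟩ | ⟨k, h1, h2, h⟩ | ⟨k, l, h1, h2, h3, n1, n2, h⟩ | ⟨hf, h⟩
    · exact ⟨fun _ => edge _ (edges_spec i j hij h), fun _ => h⟩
    · rw [h]
      exact ⟨fun h => (by cases h), fun h' => absurd h' (hG.tri (edge' _ _ h1) (edge' _ _ h2))⟩
    · rw [h]
      exact ⟨fun h => (by cases h), fun h' => absurd h' (hG.sq (edge' _ _ h1) (edge' _ _ h2)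
        (edge' _ _ h3) (inj' _ _ _ n1 h1 h2) (inj' _ _ _ n2 h2 h3))⟩
    · rw [h]
      exact ⟨fun h => (by cases h), fun h' => absurd h' (hfar _ hf)⟩

/-- Adjacency in the tree on `Fin n` in which the parent of `j ≠ 0` is `p j < j`. -/
def parentAdj {n : ℕ} (p : Fin n → Fin n) (i j : Fin n) : Bool :=
  (decide (i < j) && decide (p j = i)) || (decide (j < i) && decide (p i = j))

theorem treeT81_adj : ∀ i j : Fin 12, treeT81.Adj i j ↔
    parentAdj ![0, 0, 1, 2, 3, 4, 5, 6, 2, 8, 4, 5] i j = true := by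
  intro i j
  simp only [treeT81, fromEdgeSet_adj, Set.mem_insert_iff, Set.mem_singleton_iff, Sym2.eq_iff]
  fin_cases i <;> fin_cases j <;> decide

/-- `sib` consists of the pairs at tree distance two and `far` of those at distance at least four;
chords at distance two or three are excluded by the girth. The criteria for the other two trees have
the same shape. -/
theorem treeT81_isIndContained (hG : G.Sparse) {u₁ u₂ u₃ u₄ u₅ u₆ u₇ u₈ v v' w₅ w₆ : V}
    (edge : G.Adj u₁ u₂ ∧ G.Adj u₂ u₃ ∧ G.Adj u₃ u₄ ∧ G.Adj u₄ u₅ ∧ G.Adj u₅ u₆ ∧ G.Adj u₆ u₇ ∧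
      G.Adj u₇ u₈ ∧ G.Adj u₃ v ∧ G.Adj v v' ∧ G.Adj u₅ w₅ ∧ G.Adj u₆ w₆)
    (sib : u₁ ≠ u₃ ∧ u₂ ≠ u₄ ∧ u₂ ≠ v ∧ u₃ ≠ u₅ ∧ u₃ ≠ v' ∧ u₄ ≠ u₆ ∧ u₄ ≠ v ∧ u₄ ≠ w₅ ∧ u₅ ≠ u₇
      ∧ u₅ ≠ w₆ ∧ u₆ ≠ u₈ ∧ u₆ ≠ w₅ ∧ u₇ ≠ w₆)
    (far : (∀ a ∈ [u₅, u₆, u₇, u₈, v', w₅, w₆], ¬ G.Adj u₁ a) ∧ (∀ a ∈ [u₆, u₇, u₈, w₅, w₆], ¬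
      G.Adj u₂ a) ∧ (∀ a ∈ [u₇, u₈, w₆], ¬ G.Adj u₃ a) ∧ (∀ a ∈ [u₈], ¬ G.Adj u₄ a) ∧ (∀ a ∈ [v'],
      ¬ G.Adj u₅ a) ∧ (∀ a ∈ [v, v'], ¬ G.Adj u₆ a) ∧ (∀ a ∈ [v, v'], ¬ G.Adj u₇ a) ∧ (∀ a ∈ [v,
      v', w₅], ¬ G.Adj u₈ a) ∧ (∀ a ∈ [w₅, w₆], ¬ G.Adj v a) ∧ (∀ a ∈ [w₅, w₆], ¬ G.Adj v' a)) :
    treeT81.IsIndContained G := by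
  refine hG.isIndContained_of_far _ treeT81_adj
    [(0, 1), (1, 2), (2, 3), (3, 4), (4, 5), (5, 6), (6, 7), (2, 8), (8, 9), (4, 10), (5, 11)]
    [(0, 2), (1, 3), (1, 8), (2, 4), (2, 9), (3, 5), (3, 8), (3, 10), (4, 6), (4, 11), (5, 7), (5,
    10), (6, 11)]
    [(0, 4), (0, 5), (0, 6), (0, 7), (0, 9), (0, 10), (0, 11), (1, 5), (1, 6), (1, 7), (1, 10),
    (1, 11), (2, 6), (2, 7), (2, 11), (3, 7), (4, 9), (5, 8), (5, 9), (6, 8), (6, 9), (7, 8), (7,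
    9), (7, 10), (8, 10), (8, 11), (9, 10), (9, 11)]
    ![u₁, u₂, u₃, u₄, u₅, u₆, u₇, u₈, v, v', w₅, w₆] (by decide) (by decide) (by decide) (by decide) ?_ ?_ ?_
  · simpa [-not_or] using edge
  · simpa [-not_or] using sib
  · simpa [and_assoc] using far

theorem treeT82_adj : ∀ i j : Fin 11, treeT82.Adj i j ↔
    parentAdj ![0, 0, 1, 2, 3, 4, 5, 6, 2, 8, 3] i j = true := by
  intro i j
  simp only [treeT82, fromEdgeSet_adj, Set.mem_insert_iff, Set.mem_singleton_iff, Sym2.eq_iff]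
  fin_cases i <;> fin_cases j <;> decide

theorem treeT82_isIndContained (hG : G.Sparse) {u₁ u₂ u₃ u₄ u₅ u₆ u₇ u₈ v v' w : V}
    (edge : G.Adj u₁ u₂ ∧ G.Adj u₂ u₃ ∧ G.Adj u₃ u₄ ∧ G.Adj u₄ u₅ ∧ G.Adj u₅ u₆ ∧ G.Adj u₆ u₇ ∧
      G.Adj u₇ u₈ ∧ G.Adj u₃ v ∧ G.Adj v v' ∧ G.Adj u₄ w)
    (sib : u₁ ≠ u₃ ∧ u₂ ≠ u₄ ∧ u₂ ≠ v ∧ u₃ ≠ u₅ ∧ u₃ ≠ v' ∧ u₃ ≠ w ∧ u₄ ≠ u₆ ∧ u₄ ≠ v ∧ u₅ ≠ u₇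
      ∧ u₅ ≠ w ∧ u₆ ≠ u₈)
    (far : (∀ a ∈ [u₅, u₆, u₇, u₈, v', w], ¬ G.Adj u₁ a) ∧ (∀ a ∈ [u₆, u₇, u₈], ¬ G.Adj u₂ a) ∧
      (∀ a ∈ [u₇, u₈], ¬ G.Adj u₃ a) ∧ (∀ a ∈ [u₈], ¬ G.Adj u₄ a) ∧ (∀ a ∈ [v'], ¬ G.Adj u₅ a) ∧
      (∀ a ∈ [v, v'], ¬ G.Adj u₆ a) ∧ (∀ a ∈ [v, v', w], ¬ G.Adj u₇ a) ∧ (∀ a ∈ [v, v', w], ¬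
      G.Adj u₈ a) ∧ (∀ a ∈ [w], ¬ G.Adj v' a)) :
    treeT82.IsIndContained G := by
  refine hG.isIndContained_of_far _ treeT82_adj
    [(0, 1), (1, 2), (2, 3), (3, 4), (4, 5), (5, 6), (6, 7), (2, 8), (8, 9), (3, 10)]
    [(0, 2), (1, 3), (1, 8), (2, 4), (2, 9), (2, 10), (3, 5), (3, 8), (4, 6), (4, 10), (5, 7)]
    [(0, 4), (0, 5), (0, 6), (0, 7), (0, 9), (0, 10), (1, 5), (1, 6), (1, 7), (2, 6), (2, 7), (3,
    7), (4, 9), (5, 8), (5, 9), (6, 8), (6, 9), (6, 10), (7, 8), (7, 9), (7, 10), (9, 10)]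
    ![u₁, u₂, u₃, u₄, u₅, u₆, u₇, u₈, v, v', w] (by decide) (by decide) (by decide) (by decide) ?_ ?_ ?_
  · simpa [-not_or] using edge
  · simpa [-not_or] using sib
  · simpa [and_assoc] using far

theorem treeT9_adj : ∀ i j : Fin 11, treeT9.Adj i j ↔
    parentAdj ![0, 0, 1, 2, 3, 4, 5, 6, 7, 2, 9] i j = true := by
  intro i j
  simp only [treeT9, fromEdgeSet_adj, Set.mem_insert_iff, Set.mem_singleton_iff, Sym2.eq_iff]
  fin_cases i <;> fin_cases j <;> decide

theorem treeT9_isIndContained (hG : G.Sparse) {u₁ u₂ u₃ u₄ u₅ u₆ u₇ u₈ u₉ v v' : V}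
    (edge : G.Adj u₁ u₂ ∧ G.Adj u₂ u₃ ∧ G.Adj u₃ u₄ ∧ G.Adj u₄ u₅ ∧ G.Adj u₅ u₆ ∧ G.Adj u₆ u₇ ∧
      G.Adj u₇ u₈ ∧ G.Adj u₈ u₉ ∧ G.Adj u₃ v ∧ G.Adj v v')
    (sib : u₁ ≠ u₃ ∧ u₂ ≠ u₄ ∧ u₂ ≠ v ∧ u₃ ≠ u₅ ∧ u₃ ≠ v' ∧ u₄ ≠ u₆ ∧ u₄ ≠ v ∧ u₅ ≠ u₇ ∧ u₆ ≠ u₈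
      ∧ u₇ ≠ u₉)
    (far : (∀ a ∈ [u₅, u₆, u₇, u₈, u₉, v'], ¬ G.Adj u₁ a) ∧ (∀ a ∈ [u₆, u₇, u₈, u₉], ¬ G.Adj u₂
      a) ∧ (∀ a ∈ [u₇, u₈, u₉], ¬ G.Adj u₃ a) ∧ (∀ a ∈ [u₈, u₉], ¬ G.Adj u₄ a) ∧ (∀ a ∈ [u₉, v'],
      ¬ G.Adj u₅ a) ∧ (∀ a ∈ [v, v'], ¬ G.Adj u₆ a) ∧ (∀ a ∈ [v, v'], ¬ G.Adj u₇ a) ∧ (∀ a ∈ [v,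
      v'], ¬ G.Adj u₈ a) ∧ (∀ a ∈ [v, v'], ¬ G.Adj u₉ a)) :
    treeT9.IsIndContained G := by
  refine hG.isIndContained_of_far _ treeT9_adj
    [(0, 1), (1, 2), (2, 3), (3, 4), (4, 5), (5, 6), (6, 7), (7, 8), (2, 9), (9, 10)]
    [(0, 2), (1, 3), (1, 9), (2, 4), (2, 10), (3, 5), (3, 9), (4, 6), (5, 7), (6, 8)]
    [(0, 4), (0, 5), (0, 6), (0, 7), (0, 8), (0, 10), (1, 5), (1, 6), (1, 7), (1, 8), (2, 6), (2,
    7), (2, 8), (3, 7), (3, 8), (4, 8), (4, 10), (5, 9), (5, 10), (6, 9), (6, 10), (7, 9), (7,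
    10), (8, 9), (8, 10)]
    ![u₁, u₂, u₃, u₄, u₅, u₆, u₇, u₈, u₉, v, v'] (by decide) (by decide) (by decide) (by decide) ?_ ?_ ?_
  · simpa [-not_or] using edge
  · simpa [-not_or] using sib
  · simpa [and_assoc] using far

end SimpleGraph

/-! ### Independent sets in digraphs of bounded out-degree -/

/-- Greedy choice: out-degrees at most `c` force some vertex to have in-degree plus out-degree at
most `2 * c`. Choosing it costs at most `2 * c + 1` vertices. -/
theorem Finset.exists_injective_pairwise_not_rel {α : Type*} (R : α → α → Prop) (c k : ℕ)
    (s : Finset α) (hR : ∀ a ∈ s, ∀ t ⊆ s, (∀ b ∈ t, R a b) → t.card ≤ c)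
    (hk : k * (2 * c + 1) ≤ s.card) :
    ∃ f : Fin k → α, Function.Injective f ∧ (∀ i, f i ∈ s) ∧ ∀ i j, i ≠ j → ¬ R (f i) (f j) := by
  classical
  induction k generalizing s with
  | zero => exact ⟨Fin.elim0, fun i => i.elim0, fun i => i.elim0, fun i => i.elim0⟩
  | succ k ih =>
    have hpos : s.Nonempty := by
      rw [← Finset.card_pos]; nlinarith
    obtain ⟨a, ha, hac⟩ : ∃ a ∈ s, (s.filter (R a)).card + (s.filter fun b => R b a).card ≤ 2 * c := by
      by_contra! hcon
      have h1 : ∑ a ∈ s, (s.filter (R a)).card = ∑ a ∈ s, (s.filter fun b => R b a).card :=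
        Finset.sum_card_bipartiteAbove_eq_sum_card_bipartiteBelow R
      have h2 : ∑ a ∈ s, (s.filter (R a)).card ≤ s.card * c := by
        rw [← smul_eq_mul]
        exact Finset.sum_le_card_nsmul _ _ _ fun a ha =>
          hR a ha _ (Finset.filter_subset _ _) fun b hb => (Finset.mem_filter.1 hb).2
      have h3 : s.card * (2 * c + 1) ≤
          ∑ a ∈ s, ((s.filter (R a)).card + (s.filter fun b => R b a).card) := by
        rw [← smul_eq_mul]
        exact Finset.card_nsmul_le_sum _ _ _ fun a ha => hcon a ha
      rw [Finset.sum_add_distrib] at h3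
      have := Finset.card_pos.2 hpos
      nlinarith
    set s' := s.filter fun b => b ≠ a ∧ ¬ R a b ∧ ¬ R b a with hs'
    have hcard : s.card ≤ s'.card + 2 * c + 1 := by
      have : s ⊆ s' ∪ ((s.filter (R a)) ∪ ((s.filter fun b => R b a) ∪ {a})) := by
        intro b hb
        simp only [hs', Finset.mem_union, Finset.mem_filter, Finset.mem_singleton]
        tauto
      have h1 := Finset.card_le_card this
      have h2 := Finset.card_union_le s' ((s.filter (R a)) ∪ ((s.filter fun b => R b a) ∪ {a}))
      have h3 := Finset.card_union_le (s.filter (R a)) ((s.filter fun b => R b a) ∪ {a})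
      have h4 := Finset.card_union_le (s.filter fun b => R b a) {a}
      rw [Finset.card_singleton] at h4
      omega
    have hs's : s' ⊆ s := Finset.filter_subset _ _
    obtain ⟨f, hf, hfs, hfR⟩ := ih s'
      (fun b hb t ht hbt => hR b (hs's hb) t (ht.trans hs's) hbt) (by nlinarith)
    have hfs' : ∀ i, f i ≠ a ∧ ¬ R a (f i) ∧ ¬ R (f i) a := fun i => (Finset.mem_filter.1 (hfs i)).2
    refine ⟨Fin.cons a f, ?_, ?_, ?_⟩
    · rw [Fin.cons_injective_iff]
      exact ⟨fun ⟨i, hi⟩ => (hfs' i).1 hi, hf⟩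
    · intro i
      refine Fin.cases ha (fun j => ?_) i
      simpa using hs's (hfs j)
    · intro i j hij
      induction i using Fin.cases with
      | zero =>
        induction j using Fin.cases with
        | zero => exact absurd rfl hij
        | succ j => simpa using (hfs' j).2.1
      | succ i =>
        induction j using Fin.cases with
        | zero => simpa using (hfs' i).2.2
        | succ j => simpa using hfR i j fun h => hij (by rw [h])

/-! ### Vertices at distance at least two from `x` -/

namespace SimpleGraph

variable {V : Type*} {G : SimpleGraph V}

/-- Two distinct vertices have at most one common neighbour. -/
theorem Sparse.common_eq (hG : G.Sparse) {a b c d : V} (hab : a ≠ b) (h₁ : G.Adj a c)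
    (h₂ : G.Adj b c) (h₃ : G.Adj a d) (h₄ : G.Adj b d) : c = d := by
  by_contra h
  exact hG.sq h₁ h₂.symm h₄ hab h h₃

/-- `v` is at distance at least two from `x`. -/
def Far (G : SimpleGraph V) (x v : V) : Prop := v ≠ x ∧ ¬ G.Adj x v

theorem Sparse.far_of_adj (hG : G.Sparse) {x y z : V} (h₁ : G.Adj x y) (h₂ : G.Adj y z)
    (h : z ≠ x) : G.Far x z := ⟨h, hG.tri h₁ h₂⟩

theorem Sparse.far_of_adj_adj (hG : G.Sparse) {x y z w : V} (h₁ : G.Adj x y) (h₂ : G.Adj y z)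
    (h : z ≠ x) (h₃ : G.Adj z w) (h' : w ≠ y) : G.Far x w :=
  ⟨by rintro rfl; exact hG.tri h₁ h₂ h₃.symm, hG.sq h₁ h₂ h₃ h.symm h'.symm⟩

theorem Sparse.parent_eq (hG : G.Sparse) {x y y' v : V} (hv : G.Far x v) (h₁ : G.Adj x y)
    (h₂ : G.Adj y v) (h₃ : G.Adj x y') (h₄ : G.Adj y' v) : y = y' :=
  hG.common_eq hv.1.symm h₁ h₂.symm h₃ h₄.symm

/-- Only one neighbour of `v` can be adjacent to `x`, as two would close a 4-cycle; so walks among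
far vertices can always be continued without backtracking. -/
theorem Sparse.exists_far (hG : G.Sparse) {x v : V} (hv : G.Far x v) (a : V) :
    ∃ c, G.Far x c ∧ G.Adj v c ∧ c ≠ a := by
  obtain ⟨c, hc, hca, -⟩ := hG.third v a a
  obtain ⟨d, hd, hda, hdc⟩ := hG.third v a c
  have hx : ∀ {u}, G.Adj v u → u ≠ x := by rintro u hu rfl; exact hv.2 hu.symm
  by_cases h : G.Adj x c
  · by_cases h' : G.Adj x d
    · exact absurd (hG.common_eq hv.1 hc h hd h').symm hdc
    · exact ⟨d, ⟨hx hd, h'⟩, hd, hda⟩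
  · exact ⟨c, ⟨hx hc, h⟩, hc, hca⟩

/-- A far vertex with at most two far neighbours is adjacent to a neighbour of `x`. -/
theorem Sparse.exists_parent (hG : G.Sparse) {x v : V} (hv : G.Far x v) {a b : V}
    (h : ∀ c, G.Far x c → G.Adj v c → c = a ∨ c = b) : ∃ y, G.Adj x y ∧ G.Adj y v := by
  obtain ⟨c, hc, hca, hcb⟩ := hG.third v a b
  have hx : c ≠ x := by rintro rfl; exact hv.2 hc.symm
  by_cases h' : G.Adj x c
  · exact ⟨c, h', hc.symm⟩
  · rcases h c ⟨hx, h'⟩ hc with h | h <;> contradiction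

end SimpleGraph

/-- Used on the far neighbours of a vertex with more than four of them: three survive two
exceptional conditions that each hold at most once. -/
theorem Finset.exists_ne_of_four_lt_card {α : Type*} {s : Finset α} (hs : 4 < s.card)
    {P Q : α → Prop} (hP : ∀ a ∈ s, ∀ b ∈ s, P a → P b → a = b)
    (hQ : ∀ a ∈ s, ∀ b ∈ s, Q a → Q b → a = b) :
    ∃ a b c, (a ∈ s ∧ ¬ P a ∧ ¬ Q a) ∧ (b ∈ s ∧ ¬ P b ∧ ¬ Q b) ∧ (c ∈ s ∧ ¬ P c ∧ ¬ Q c) ∧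
      a ≠ b ∧ a ≠ c ∧ b ≠ c := by
  classical
  have h1 : (s.filter P).card ≤ 1 := Finset.card_le_one.2 fun a ha b hb => by
    rw [Finset.mem_filter] at ha hb; exact hP a ha.1 b hb.1 ha.2 hb.2
  have h2 : (s.filter Q).card ≤ 1 := Finset.card_le_one.2 fun a ha b hb => by
    rw [Finset.mem_filter] at ha hb; exact hQ a ha.1 b hb.1 ha.2 hb.2
  have h3 : s ⊆ (s.filter fun a => ¬ P a ∧ ¬ Q a) ∪ (s.filter P ∪ s.filter Q) := by
    intro a ha
    simp only [Finset.mem_union, Finset.mem_filter]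
    tauto
  have h4 := Finset.card_le_card h3
  have h5 := Finset.card_union_le (s.filter fun a => ¬ P a ∧ ¬ Q a) (s.filter P ∪ s.filter Q)
  have h6 := Finset.card_union_le (s.filter P) (s.filter Q)
  have h7 : 2 < (s.filter fun a => ¬ P a ∧ ¬ Q a).card := by omega
  obtain ⟨a, ha, b, hb, c, hc, h⟩ := Finset.two_lt_card.1 h7
  rw [Finset.mem_filter] at ha hb hc
  exact ⟨a, b, c, ha, hb, hc, h⟩

theorem Finset.card_le_four_of_cover {α : Type*} {s : Finset α} {P Q R : α → Prop}
    (hP : ∀ a ∈ s, ∀ b ∈ s, P a → P b → a = b) (hQ : ∀ a ∈ s, ∀ b ∈ s, Q a → Q b → a = b)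
    (hR : ∀ a ∈ s, ∀ b ∈ s, R a → R b → a = b) (h : ∀ a ∈ s, P a ∨ Q a ∨ R a) : s.card ≤ 4 := by
  by_contra! hs
  obtain ⟨a, b, -, ha, hb, -, hab, -⟩ := Finset.exists_ne_of_four_lt_card hs hP hQ
  have h1 := h a ha.1
  have h2 := h b hb.1
  exact hab (hR a ha.1 b hb.1 (by tauto) (by tauto))

namespace SimpleGraph

variable {V : Type*} {G : SimpleGraph V}

/-- Adjacency in the subgraph induced by the vertices at distance at least two from `x`. -/
def FarAdj (G : SimpleGraph V) (x a b : V) : Prop := G.Far x a ∧ G.Far x b ∧ G.Adj a b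

theorem FarAdj.symm {x a b : V} (h : G.FarAdj x a b) : G.FarAdj x b a := ⟨h.2.1, h.1, h.2.2.symm⟩

theorem FarAdj.adj {x a b : V} (h : G.FarAdj x a b) : G.Adj a b := h.2.2

/-- `v` is at distance two from `x`, via the neighbour `y` of `x`. -/
def Child (G : SimpleGraph V) (x y v : V) : Prop := G.Adj x y ∧ G.Adj y v ∧ G.Far x v

open Classical in
/-- The neighbours of `v` at distance at least two from `x`. -/
noncomputable def farNbrs [Fintype V] (G : SimpleGraph V) (x v : V) : Finset V :=
  Finset.univ.filter fun c => G.FarAdj x v c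

theorem mem_farNbrs [Fintype V] {x v c : V} : c ∈ G.farNbrs x v ↔ G.FarAdj x v c := by
  simp [farNbrs]

theorem Sparse.farAdj_common_eq (hG : G.Sparse) {x a b c d : V} (hab : a ≠ b)
    (h₁ : G.FarAdj x a c) (h₂ : G.FarAdj x b c) (h₃ : G.FarAdj x a d) (h₄ : G.FarAdj x b d) :
    c = d := hG.common_eq hab h₁.adj h₂.adj h₃.adj h₄.adj

theorem Sparse.farAdj_tri (hG : G.Sparse) {x a b c : V}
    (h₁ : G.FarAdj x a b) (h₂ : G.FarAdj x b c) (h₃ : G.FarAdj x a c) : False :=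
  hG.tri h₁.adj h₂.adj h₃.adj

theorem Sparse.child_unique (hG : G.Sparse) {x y y' v : V} (h : G.Child x y v)
    (h' : G.Child x y' v) : y = y' := hG.parent_eq h.2.2 h.1 h.2.1 h'.1 h'.2.1

theorem Sparse.child_not_adj (hG : G.Sparse) {x y a b : V} (h : G.Child x y a)
    (h' : G.Child x y b) (hab : G.FarAdj x a b) : False := hG.tri h.2.1 hab.adj h'.2.1

theorem Sparse.child_common (hG : G.Sparse) {x y a b c : V} (h : G.Child x y a)
    (h' : G.Child x y b) (ha : G.FarAdj x a c) (hb : G.FarAdj x b c) : a = b := by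
  by_contra hab
  exact hG.sq h.2.1.symm h'.2.1 hb.adj hab
    (by rintro rfl; exact ha.2.1.2 h.1) ha.adj

theorem Sparse.exists_farAdj (hG : G.Sparse) {x v : V} (hv : G.Far x v) (a : V) :
    ∃ c, G.FarAdj x v c ∧ c ≠ a := by
  obtain ⟨c, h1, h2, h3⟩ := hG.exists_far hv a
  exact ⟨c, ⟨hv, h1, h2⟩, h3⟩

theorem Sparse.exists_child_of_farAdj (hG : G.Sparse) {x v : V} (hv : G.Far x v) {a b : V}
    (h : ∀ c, G.FarAdj x v c → c = a ∨ c = b) : ∃ y, G.Child x y v := by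
  obtain ⟨y, h1, h2⟩ := hG.exists_parent hv fun c h1 h2 => h c ⟨hv, h1, h2⟩
  exact ⟨y, h1, h2, hv⟩

/-- A vertex `y` adjacent to `x` has a second child. -/
theorem Sparse.exists_sibling (hG : G.Sparse) {x y v : V} (h : G.Child x y v) :
    ∃ l, G.Child x y l ∧ l ≠ v := by
  obtain ⟨l, h1, h2, h3⟩ := hG.third y x v
  exact ⟨l, ⟨h.1, h1, hG.far_of_adj h.1 h1 h2⟩, h3⟩

/-! ### Forbidden stems and the degree bounds they force -/

/-- The path `x y z₁ ⋯ z₅` plays `u₃ ⋯ u₉` of `T₉`. The pairs `y z₄`, `y z₅`, `z₁ z₅` are the only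
possible chords of `y z₁ ⋯ z₅` that the girth does not exclude. -/
def NoStemNine (G : SimpleGraph V) (x : V) : Prop :=
  ∀ y z₁ z₂ z₃ z₄ z₅, G.Child x y z₁ → G.FarAdj x z₁ z₂ → G.FarAdj x z₂ z₃ → G.FarAdj x z₃ z₄ →
    G.FarAdj x z₄ z₅ → z₃ ≠ z₁ → z₄ ≠ z₂ → z₅ ≠ z₃ → ¬ G.Child x y z₄ →
    G.Child x y z₅ ∨ G.FarAdj x z₁ z₅

/-- Here `x y z₁ ⋯ z₄` plays `u₃ ⋯ u₈` of `T₈⁽²⁾` and `l` is the pendant vertex at `u₄ = y`; the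
alternatives are again the chords left open by the girth. -/
def NoStemTwo (G : SimpleGraph V) (x : V) : Prop :=
  ∀ y z₁ z₂ z₃ z₄ l, G.Child x y z₁ → G.FarAdj x z₁ z₂ → G.FarAdj x z₂ z₃ → G.FarAdj x z₃ z₄ →
    G.Child x y l → z₃ ≠ z₁ → z₄ ≠ z₂ → l ≠ z₁ →
    G.Child x y z₄ ∨ G.FarAdj x l z₃ ∨ G.FarAdj x l z₄

/-- Here `x y z₁ ⋯ z₄` plays `u₃ ⋯ u₈` of `T₈⁽¹⁾`, with pendant vertices `l₂` at `z₁` and `l₃` at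
`z₂`. -/
def NoStemOne (G : SimpleGraph V) (x : V) : Prop :=
  ∀ y z₁ z₂ z₃ z₄ l₂ l₃, G.Child x y z₁ → G.FarAdj x z₁ z₂ → G.FarAdj x z₁ l₂ →
    G.FarAdj x z₂ z₃ → G.FarAdj x z₂ l₃ → G.FarAdj x z₃ z₄ →
    l₂ ≠ z₂ → z₃ ≠ z₁ → l₃ ≠ z₁ → l₃ ≠ z₃ → z₄ ≠ z₂ →
    G.Child x y z₄ ∨ G.FarAdj x l₂ z₄

variable [Fintype V] {x : V}

/-- If `z₃` had five far neighbours, three of them would have far degree two, hence parents. Stems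
entering from the parents of two of these and leaving through the third give both the same parent,
closing a 4-cycle with `z₃`. -/
theorem NoStemNine.card_of_two (hG : G.Sparse) (hF : G.NoStemNine x) {y z₁ z₂ z₃ : V}
    (hy : G.Child x y z₁) (h₁ : G.FarAdj x z₁ z₂) (h₂ : G.FarAdj x z₂ z₃) (hne : z₃ ≠ z₁) :
    (G.farNbrs x z₃).card ≤ 4 := by
  have tri := @hG.farAdj_tri
  have com := @hG.farAdj_common_eq
  have ctri := @hG.child_not_adj
  have ccom := @hG.child_common
  have cuni := @hG.child_unique
  have sy : ∀ {a b}, G.FarAdj x a b → G.FarAdj x b a := fun h => h.symm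
  by_contra! hbig
  obtain ⟨a, b, c, ⟨ha, ha1, ha2⟩, ⟨hb, hb1, hb2⟩, ⟨hc, hc1, hc2⟩, hab, hac, hbc⟩ :=
    Finset.exists_ne_of_four_lt_card hbig (P := fun v => v = z₂) (Q := fun v => G.Child x y v)
    (by rintro _ - _ - rfl h; exact h.symm)
    (by
      intro u hu v hv h h'
      rw [mem_farNbrs] at hu hv
      exact ccom h h' hu.symm hv.symm)
  rw [mem_farNbrs] at ha hb hc
  have hy3 : ¬ G.Child x y z₃ := fun h => hne (ccom h hy h₂.symm h₁)
  -- Otherwise `z₁` is adjacent to `z₅`, and the stem `y z₁ z₅ z₄ z₃ t` leaves `z₃` only `z₂`, `z₄`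
  -- and one child of `y` as neighbours.
  have key0 : ∀ z₄ z₅, G.FarAdj x z₃ z₄ → z₄ ≠ z₂ → ¬ G.Child x y z₄ → G.FarAdj x z₄ z₅ → z₅ ≠ z₃ →
      G.Child x y z₅ := by
    intro z₄ z₅ h3 hn4 hy4 h4 hn5
    rcases hF y z₁ z₂ z₃ z₄ z₅ hy h₁ h₂ h3 h4 hne hn4 hn5 hy4 with h | h
    · exact h
    exfalso
    have hn41 : z₄ ≠ z₁ := by rintro rfl; exact tri h₁ h₂ h3.symm
    have all : ∀ t, G.FarAdj x z₃ t → t ≠ z₄ → G.Child x y t ∨ G.FarAdj x z₁ t := fun t ht htn =>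
      hF y z₁ z₅ z₄ z₃ t hy h h4.symm h3.symm ht hn41 hn5.symm htn hy3
    have no : ∀ t, G.FarAdj x z₃ t → t ≠ z₂ → ¬ G.FarAdj x z₁ t := fun t ht htn h1t =>
      htn (com hne.symm h1t ht h₁ h₂.symm)
    grind
  have key : ∀ z₄, G.FarAdj x z₃ z₄ → z₄ ≠ z₂ → ¬ G.Child x y z₄ → ∃ z₅ y₄, G.FarAdj x z₄ z₅ ∧
      z₅ ≠ z₃ ∧ G.Child x y z₅ ∧ G.Child x y₄ z₄ ∧ ∀ c, G.FarAdj x z₄ c → c = z₃ ∨ c = z₅ := by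
    intro z₄ h3 hn4 hy4
    obtain ⟨z₅, h5, hn5⟩ := hG.exists_farAdj h3.2.1 z₃
    have hall : ∀ c, G.FarAdj x z₄ c → c = z₃ ∨ c = z₅ := by
      intro c hc
      by_contra! hcon
      exact hcon.2 (ccom (key0 z₄ c h3 hn4 hy4 hc hcon.1) (key0 z₄ z₅ h3 hn4 hy4 h5 hn5)
        hc.symm h5.symm)
    obtain ⟨y₄, hy4'⟩ := hG.exists_child_of_farAdj h3.2.1 hall
    exact ⟨z₅, y₄, h5, hn5, key0 z₄ z₅ h3 hn4 hy4 h5 hn5, hy4', hall⟩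
  obtain ⟨a5, ya, a1, a2, a3, a4, a6⟩ := key a ha ha1 ha2
  obtain ⟨b5, yb, b1, b2, b3, b4, b6⟩ := key b hb hb1 hb2
  obtain ⟨c5, yc, c1, c2, c3, c4, c6⟩ := key c hc hc1 hc2
  obtain ⟨t, ht, htn⟩ := hG.exists_farAdj c1.2.1 c
  have fin : ∀ a5 a ya, G.FarAdj x z₃ a → a ≠ c → ¬ G.Child x y a → G.Child x y a5 →
      G.FarAdj x a a5 → G.Child x ya a → 
      (∀ c, G.FarAdj x a c → c = z₃ ∨ c = a5) → G.Child x ya t := by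
    intro a5 a ya ha hac hya hya5 h5 hyaa hall
    rcases hF ya a z₃ c c5 t hyaa ha.symm hc c1 ht hac.symm c2 htn
      (fun h => hya (by rwa [cuni h c3] at hyaa)) with h | h
    · exact h
    · rcases hall t h with rfl | rfl
      · exact (tri hc c1 ht.symm).elim
      · exact (ctri c3 hya5 ht).elim
  have e1 := fin a5 a ya ha hac ha2 a3 a1 a4 a6
  have e2 := fin b5 b yb hb hbc hb2 b3 b1 b4 b6
  have := cuni e1 e2
  subst this
  exact hab (ccom a4 b4 ha.symm hb.symm)

/-- Walk on from `z₂` to `z₃`, `z₄`. If `z₄` has a parent, `z₂` is two steps from the child `z₄`. If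
a continuation `z₅` is a child of `y`, the reversed stem from `z₅` controls `z₂`. Otherwise all
continuations are adjacent to `z₁`, so there is just one and `z₄` has a parent after all. -/
theorem NoStemNine.card_of_one (hG : G.Sparse) (hF : G.NoStemNine x) {y z₁ z₂ : V}
    (hy : G.Child x y z₁) (h₁ : G.FarAdj x z₁ z₂) : (G.farNbrs x z₂).card ≤ 4 := by
  have tri := @hG.farAdj_tri
  have com := @hG.farAdj_common_eq
  have ctri := @hG.child_not_adj
  have ccom := @hG.child_common
  obtain ⟨z₃, h2, hn3⟩ := hG.exists_farAdj h₁.2.1 z₁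
  obtain ⟨z₄, h3, hn4⟩ := hG.exists_farAdj h2.2.1 z₂
  by_cases hy4 : G.Child x y z₄
  · exact hF.card_of_two hG hy4 h3.symm h2.symm hn4.symm
  by_cases hex : ∃ z₅, G.FarAdj x z₄ z₅ ∧ z₅ ≠ z₃ ∧ G.Child x y z₅
  · obtain ⟨z₅, h4, hn5, hy5⟩ := hex
    have hn42 : ∀ t, G.FarAdj x z₂ t → t ≠ z₃ → G.Child x y t ∨ G.FarAdj x z₅ t := fun t ht htn =>
      hF y z₅ z₄ z₃ z₂ t hy5 h4.symm h3.symm h2.symm ht hn5.symm hn4.symm htn (fun h => ctri hy h h₁)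
    have hne : z₅ ≠ z₂ := by rintro rfl; exact ctri hy hy5 h₁
    refine Finset.card_le_four_of_cover (P := fun t => t = z₃) (Q := fun t => G.Child x y t)
      (R := fun t => G.FarAdj x z₅ t) ?_ ?_ ?_ ?_
    · rintro _ - _ - rfl h; exact h.symm
    · intro u hu v hv h h'
      rw [mem_farNbrs] at hu hv
      exact ccom h h' hu.symm hv.symm
    · intro u hu v hv h h'
      rw [mem_farNbrs] at hu hv
      exact com hne h hu h' hv
    · intro t ht
      rw [mem_farNbrs] at ht
      by_cases h : t = z₃
      · exact .inl h
      · exact .inr (hn42 t ht h)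
  · push Not at hex
    have all : ∀ z₅, G.FarAdj x z₄ z₅ → z₅ ≠ z₃ → G.FarAdj x z₁ z₅ := fun z₅ h hn =>
      (hF y z₁ z₂ z₃ z₄ z₅ hy h₁ h2 h3 h hn3 hn4 hn hy4).resolve_left (hex z₅ h hn)
    obtain ⟨z₅, h4, hn5⟩ := hG.exists_farAdj h3.2.1 z₃
    have hn14 : z₁ ≠ z₄ := by rintro rfl; exact tri h₁ h2 h3.symm
    obtain ⟨y₄, hy4'⟩ := hG.exists_child_of_farAdj (a := z₃) (b := z₅) h3.2.1 (fun c hc => by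
      by_contra! hcon
      exact hcon.2 (com hn14 (all c hc hcon.1) hc (all z₅ h4 hn5) h4))
    exact hF.card_of_two hG hy4' h3.symm h2.symm hn4.symm

/-- If `z₃` had five far neighbours, `y` would have exactly one other child `l`, and the stem
through `l` shows that suitable neighbours `a`, `b`, `c` of `z₃` have single continuations, all
adjacent to `z₁`. Stems through the parent of `a` then contradict the absence of short cycles. -/
theorem NoStemTwo.card_of_two (hG : G.Sparse) (hF : G.NoStemTwo x) {y z₁ z₂ z₃ : V}
    (hy : G.Child x y z₁) (h₁ : G.FarAdj x z₁ z₂) (h₂ : G.FarAdj x z₂ z₃) (hne : z₃ ≠ z₁) :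
    (G.farNbrs x z₃).card ≤ 4 := by
  have tri := @hG.farAdj_tri
  have com := @hG.farAdj_common_eq
  have ctri := @hG.child_not_adj
  have ccom := @hG.child_common
  have cuni := @hG.child_unique
  by_contra! hbig
  have hy3 : ¬ G.Child x y z₃ := fun h => hne (ccom h hy h₂.symm h₁)
  -- If `l` is not adjacent to `z₃`, every neighbour of `z₃` is `z₂`, a child of `y` or adjacent to
  -- `l`, and each kind occurs at most once.
  have child3 : ∀ l, G.Child x y l → l ≠ z₁ → G.FarAdj x l z₃ := by
    intro l hl hln
    by_contra hl3
    refine absurd hbig (not_lt.2 (Finset.card_le_four_of_cover (P := fun t => t = z₂)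
      (Q := fun t => G.Child x y t) (R := fun t => G.FarAdj x l t) ?_ ?_ ?_ ?_))
    · rintro _ - _ - rfl h; exact h.symm
    · intro u hu v hv h h'
      rw [mem_farNbrs] at hu hv
      exact ccom h h' hu.symm hv.symm
    · intro u hu v hv h h'
      rw [mem_farNbrs] at hu hv
      exact com (by rintro rfl; exact hy3 hl) h hu h' hv
    · intro t ht
      rw [mem_farNbrs] at ht
      by_cases htn : t = z₂
      · exact .inl htn
      · have := hF y z₁ z₂ z₃ t l hy h₁ h₂ ht hl hne htn hln
        tauto
  obtain ⟨l, hl, hln⟩ := hG.exists_sibling hy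
  have hl3 := child3 l hl hln
  obtain ⟨a, b, c, ⟨ha, ha1, ha2⟩, ⟨hb, hb1, hb2⟩, ⟨hc, hc1, hc2⟩, hab, hac, hbc⟩ :=
    Finset.exists_ne_of_four_lt_card hbig (P := fun v => v = z₂) (Q := fun v => v = l)
    (by rintro _ - _ - rfl h; exact h.symm) (by rintro _ - _ - rfl h; exact h.symm)
  rw [mem_farNbrs] at ha hb hc
  have huniq : ∀ l', G.Child x y l' → l' ≠ z₁ → l' = l := fun l' h h' =>
    ccom h hl (child3 l' h h') hl3
  have key : ∀ z₄, G.FarAdj x z₃ z₄ → z₄ ≠ z₂ → z₄ ≠ l → ¬ G.Child x y z₄ ∧ ∃ s y₄,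
      G.FarAdj x z₄ s ∧ s ≠ z₃ ∧ G.FarAdj x z₁ s ∧ G.Child x y₄ z₄ ∧
      ∀ c, G.FarAdj x z₄ c → c = z₃ ∨ c = s := by
    intro z₄ h3 hn4 hn4l
    have h14 : ¬ G.FarAdj x z₁ z₄ := fun h => hn4 (com hne.symm h h3 h₁ h₂.symm)
    have hn41 : z₄ ≠ z₁ := by rintro rfl; exact tri h₁ h₂ h3.symm
    have all : ∀ s, G.FarAdj x z₄ s → s ≠ z₃ → G.FarAdj x z₁ s := by
      intro s h4 hns
      rcases hF y l z₃ z₄ s z₁ hl hl3 h3 h4 hy hn4l hns hln.symm with h | h | h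
      · by_cases hs1 : s = z₁
        · subst hs1; exact absurd h4.symm h14
        · have := huniq s h hs1
          subst this
          exact (tri h3 h4 hl3.symm).elim
      · exact absurd h h14
      · exact h
    obtain ⟨s, h4, hns⟩ := hG.exists_farAdj h3.2.1 z₃
    have hall : ∀ c, G.FarAdj x z₄ c → c = z₃ ∨ c = s := by
      intro c hc
      by_contra! hcon
      exact hcon.2 (com hn41 hc (all c hc hcon.1) h4 (all s h4 hns))
    obtain ⟨y₄, hy4⟩ := hG.exists_child_of_farAdj h3.2.1 hall
    exact ⟨fun h => hn4l (huniq z₄ h hn41), s, y₄, h4, hns, all s h4 hns, hy4, hall⟩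
  obtain ⟨a0, sa, ya, a1, a2, a3, a4, a5⟩ := key a ha ha1 ha2
  obtain ⟨b0, sb, yb, b1, b2, b3, b4, b5⟩ := key b hb hb1 hb2
  obtain ⟨c0, sc, yc, c1, c2, c3, c4, c5⟩ := key c hc hc1 hc2
  have walk : ∀ l' b sb, G.Child x ya l' → l' ≠ a → G.FarAdj x z₃ b → b ≠ a →
      G.FarAdj x b sb → sb ≠ z₃ → (∀ c, G.FarAdj x b c → c = z₃ ∨ c = sb) →
      G.Child x ya sb ∨ G.FarAdj x l' sb := by
    intro l' b sb hl' hl'n hb hba b1 b2 b5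
    rcases hF ya a z₃ b sb l' a4 ha.symm hb b1 hl' hba b2 hl'n with h | h | h
    · exact .inl h
    · rcases b5 l' h.symm with rfl | rfl
      · exact (ctri a4 hl' ha.symm).elim
      · exact .inl hl'
    · exact .inr h
  have hbsc : sb ≠ sc := by
    rintro rfl
    exact hbc (com b2.symm hb b1.symm hc c1.symm )
  have h1a : ¬ G.FarAdj x z₁ a := fun h => ha1 (com hne.symm h ha h₁ h₂.symm)
  have notboth : ¬ (G.Child x ya sb ∧ G.Child x ya sc) := fun ⟨h, h'⟩ =>
    hbsc (ccom h h' b3.symm c3.symm)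
  obtain ⟨l', hl', hl'n⟩ := hG.exists_sibling a4
  -- A continuation that is itself a child of `ya` serves as the pendant vertex of the next stem.
  by_cases hB : G.Child x ya sb
  · rcases walk sb c sc hB (by rintro rfl; exact h1a b3) hc hac.symm c1 c2 c5 with h | h
    · exact notboth ⟨hB, h⟩
    · exact tri b3 h c3
  by_cases hC : G.Child x ya sc
  · rcases walk sc b sb hC (by rintro rfl; exact h1a c3) hb hab.symm b1 b2 b5 with h | h
    · exact notboth ⟨h, hC⟩
    · exact tri c3 h b3
  have e1 := (walk l' b sb hl' hl'n hb hab.symm b1 b2 b5).resolve_left hB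
  have e2 := (walk l' c sc hl' hl'n hc hac.symm c1 c2 c5).resolve_left hC
  have := com hbsc e1.symm e2.symm b3.symm c3.symm
  subst this
  have := cuni hl' hy
  subst this
  exact a0 a4

/-- By `NoStemTwo.card_of_two`, a vertex `z₂` of large far degree is never two steps from a child.
Hence continuations through `z₂` are all adjacent to `l`, and also to a sibling `l'` of `a`. So `l'
= l`, and `a` and `z₁` are children of `y` with common neighbour `z₂`. -/
theorem NoStemTwo.card_of_one (hG : G.Sparse) (hF : G.NoStemTwo x) {y z₁ z₂ : V}
    (hy : G.Child x y z₁) (h₁ : G.FarAdj x z₁ z₂) : (G.farNbrs x z₂).card ≤ 4 := by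
  have tri := @hG.farAdj_tri
  have com := @hG.farAdj_common_eq
  have ctri := @hG.child_not_adj
  have ccom := @hG.child_common
  have cuni := @hG.child_unique
  by_contra! hbig
  have no2 : ∀ y' w z, G.Child x y' w → G.FarAdj x w z → G.FarAdj x z z₂ → z₂ ≠ w → False :=
    fun y' w z h h' h'' hn => absurd hbig (not_lt.2 (hF.card_of_two hG h h' h'' hn))
  have hy2 : ¬ G.Child x y z₂ := fun h => ctri hy h h₁
  obtain ⟨l, hl, hln⟩ := hG.exists_sibling hy
  have child3 : ∀ z₃ w, G.FarAdj x z₂ z₃ → G.Child x y w → ¬ G.FarAdj x w z₃ :=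
    fun z₃ w h hw h' => no2 y w z₃ hw h' h.symm (by rintro rfl; exact hy2 hw)
  have key : ∀ z₃, G.FarAdj x z₂ z₃ → z₃ ≠ z₁ → ∃ z₄ y₃, G.FarAdj x z₃ z₄ ∧ z₄ ≠ z₂ ∧
      G.FarAdj x l z₄ ∧ G.Child x y₃ z₃ ∧ (∀ y₄, ¬ G.Child x y₄ z₄) ∧
      ∀ c, G.FarAdj x z₃ c → c = z₂ ∨ c = z₄ := by
    intro z₃ h2 hn3
    have all : ∀ z₄, G.FarAdj x z₃ z₄ → z₄ ≠ z₂ → G.FarAdj x l z₄ := by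
      intro z₄ h3 hn4
      rcases hF y z₁ z₂ z₃ z₄ l hy h₁ h2 h3 hl hn3 hn4 hln with h | h | h
      · exact absurd h3.symm (child3 z₃ z₄ h2 h)
      · exact absurd h (child3 z₃ l h2 hl)
      · exact h
    obtain ⟨z₄, h3, hn4⟩ := hG.exists_farAdj h2.2.1 z₂
    have hn3l : z₃ ≠ l := by
      rintro rfl
      exact hln (ccom hl hy h2.symm h₁)
    have hall : ∀ c, G.FarAdj x z₃ c → c = z₂ ∨ c = z₄ := by
      intro c hc
      by_contra! hcon
      exact hcon.2 (com hn3l hc (all c hc hcon.1) h3 (all z₄ h3 hn4))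
    obtain ⟨y₃, hy3⟩ := hG.exists_child_of_farAdj h2.2.1 hall
    exact ⟨z₄, y₃, h3, hn4, all z₄ h3 hn4, hy3,
      fun y₄ h => no2 y₄ z₄ z₃ h h3.symm h2.symm hn4.symm, hall⟩
  obtain ⟨a, b, c, ⟨ha, ha1, -⟩, ⟨hb, hb1, -⟩, ⟨hc, hc1, -⟩, hab, hac, hbc⟩ :=
    Finset.exists_ne_of_four_lt_card hbig (P := fun v => v = z₁) (Q := fun _ => False)
    (by rintro _ - _ - rfl h; exact h.symm) (by rintro _ - _ - h; exact h.elim)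
  rw [mem_farNbrs] at ha hb hc
  obtain ⟨a4, ya, a1, a2, a3, a5, a6, a7⟩ := key a ha ha1
  obtain ⟨b4, yb, b1, b2, b3, b5, b6, b7⟩ := key b hb hb1
  obtain ⟨c4, yc, c1, c2, c3, c5, c6, c7⟩ := key c hc hc1
  obtain ⟨l', hl', hl'n⟩ := hG.exists_sibling a5
  have walk : ∀ b b4, G.FarAdj x z₂ b → b ≠ a → G.FarAdj x b b4 → b4 ≠ z₂ →
      (∀ y₄, ¬ G.Child x y₄ b4) → (∀ c, G.FarAdj x b c → c = z₂ ∨ c = b4) →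
      G.FarAdj x l' b4 := by
    intro b b4 hb hba b1 b2 b6 b7
    rcases hF ya a z₂ b b4 l' a5 ha.symm hb b1 hl' hba b2 hl'n with h | h | h
    · exact absurd h (b6 _)
    · rcases b7 l' h.symm with rfl | rfl
      · exact (ctri a5 hl' ha.symm).elim
      · exact absurd hl' (b6 _)
    · exact h
  have e1 := walk b b4 hb hab.symm b1 b2 b6 b7
  have e2 := walk c c4 hc hac.symm c1 c2 c6 c7
  have hbc4 : b4 ≠ c4 := by
    rintro rfl
    exact hbc (com b2.symm hb b1.symm hc c1.symm)
  have := com hbc4 e1.symm e2.symm b3.symm c3.symm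
  subst this
  have := cuni hl' hl
  subst this
  exact ha1 (ccom a5 hy ha.symm h₁)

/-- A large `z₂` always supplies the pendant vertex `l₃`. Its neighbours other than `z₁` get far
degree two and hence parents, and at most one of them continues to a child of `y`. Three others
continue to neighbours of `l₂`, which are pairwise non-adjacent, so two of the three share a parent.
-/
theorem NoStemOne.card_of_one (hG : G.Sparse) (hF : G.NoStemOne x) {y z₁ z₂ : V}
    (hy : G.Child x y z₁) (h₁ : G.FarAdj x z₁ z₂) : (G.farNbrs x z₂).card ≤ 4 := by
  have tri := @hG.farAdj_tri
  have com := @hG.farAdj_common_eq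
  have ctri := @hG.child_not_adj
  have ccom := @hG.child_common
  have cuni := @hG.child_unique
  by_contra! hbig
  obtain ⟨l₂, hl2, hnl2⟩ := hG.exists_farAdj hy.2.2 z₂
  have hy2 : ¬ G.Child x y z₂ := fun h => ctri hy h h₁
  have more : ∀ u v, ∃ w, G.FarAdj x z₂ w ∧ w ≠ u ∧ w ≠ v := by
    intro u v
    obtain ⟨w, -, -, ⟨hw, h1, h2⟩, -⟩ :=
      Finset.exists_ne_of_four_lt_card hbig (P := fun w => w = u) (Q := fun w => w = v)
      (by rintro _ - _ - rfl h; exact h.symm) (by rintro _ - _ - rfl h; exact h.symm)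
    exact ⟨w, mem_farNbrs.1 hw, h1, h2⟩
  have key : ∀ z₃, G.FarAdj x z₂ z₃ → z₃ ≠ z₁ → ∃ z₄ y₃, G.FarAdj x z₃ z₄ ∧ z₄ ≠ z₂ ∧
      (G.Child x y z₄ ∨ G.FarAdj x l₂ z₄) ∧ G.Child x y₃ z₃ := by
    intro z₃ h2 hn3
    obtain ⟨l₃, hl3, hnl3, hnl3'⟩ := more z₁ z₃
    have all : ∀ z₄, G.FarAdj x z₃ z₄ → z₄ ≠ z₂ → G.Child x y z₄ ∨ G.FarAdj x l₂ z₄ :=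
      fun z₄ h3 hn4 => hF y z₁ z₂ z₃ z₄ l₂ l₃ hy h₁ hl2 h2 hl3 h3 hnl2 hn3 hnl3 hnl3' hn4
    by_cases hex : ∃ z₄, G.FarAdj x z₃ z₄ ∧ z₄ ≠ z₂ ∧ G.Child x y z₄
    · obtain ⟨z₄, h3, hn4, hy4⟩ := hex
      refine ⟨z₄, ?_⟩
      -- A third far neighbour `s` of `z₃` would be a pendant vertex for the reversed stem `y z₄ z₃
      -- z₂ t`, bounding the far degree of `z₂`.
      have hall : ∀ s, G.FarAdj x z₃ s → s = z₂ ∨ s = z₄ := by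
        intro s hs
        by_contra! hcon
        obtain ⟨m, hm, hmn⟩ := hG.exists_farAdj hy4.2.2 z₃
        refine absurd hbig (not_lt.2 (Finset.card_le_four_of_cover (P := fun t => t = z₃)
          (Q := fun t => G.Child x y t) (R := fun t => G.FarAdj x m t) ?_ ?_ ?_ ?_))
        · rintro _ - _ - rfl h; exact h.symm
        · intro u hu v hv h h'
          rw [mem_farNbrs] at hu hv
          exact ccom h h' hu.symm hv.symm
        · intro u hu v hv h h'
          rw [mem_farNbrs] at hu hv
          refine com ?_ h hu h' hv
          rintro rfl
          exact tri h2 h3 hm.symm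
        · intro t ht
          rw [mem_farNbrs] at ht
          by_cases htn : t = z₃
          · exact .inl htn
          · exact .inr (hF y z₄ z₃ z₂ t m s hy4 h3.symm hm h2.symm hs ht hmn hn4.symm
              hcon.2 hcon.1 htn)
      obtain ⟨y₃, hy3⟩ := hG.exists_child_of_farAdj h2.2.1 hall
      exact ⟨y₃, h3, hn4, .inl hy4, hy3⟩
    · push Not at hex
      obtain ⟨z₄, h3, hn4⟩ := hG.exists_farAdj h2.2.1 z₂
      have hn3l : z₃ ≠ l₂ := by rintro rfl; exact tri h₁ h2 hl2
      have hall : ∀ s, G.FarAdj x z₃ s → s = z₂ ∨ s = z₄ := by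
        intro s hs
        by_contra! hcon
        exact hcon.2 (com hn3l hs ((all s hs hcon.1).resolve_left (hex s hs hcon.1)) h3
          ((all z₄ h3 hn4).resolve_left (hex z₄ h3 hn4)))
      obtain ⟨y₃, hy3⟩ := hG.exists_child_of_farAdj h2.2.1 hall
      exact ⟨z₄, y₃, h3, hn4, all z₄ h3 hn4, hy3⟩
  have walk : ∀ a a4 ya b b4, G.FarAdj x z₂ a → G.FarAdj x z₂ b → a ≠ b → G.FarAdj x a a4 →
      a4 ≠ z₂ → G.FarAdj x b b4 → b4 ≠ z₂ → G.Child x ya a →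
      G.Child x ya b4 ∨ G.FarAdj x a4 b4 := by
    intro a a4 ya b b4 ha hb hab a1 a2 b1 b2 a3
    obtain ⟨m, hm, hm1, hm2⟩ := more a b
    exact hF ya a z₂ b b4 a4 m a3 ha.symm a1 hb hm b1 a2 hab.symm hm1 hm2 b2
  have hyc : ∀ z₃, G.FarAdj x z₂ z₃ → z₃ ≠ z₁ → ¬ G.Child x y z₃ := fun z₃ h hn h' =>
    hn (ccom h' hy h.symm h₁)
  obtain ⟨a, b, c, ⟨ha, ha1, ha2⟩, ⟨hb, hb1, hb2⟩, ⟨hc, hc1, hc2⟩, hab, hac, hbc⟩ :=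
    Finset.exists_ne_of_four_lt_card hbig (P := fun v => v = z₁)
    (Q := fun v => v ≠ z₁ ∧ ∃ z₄, G.FarAdj x v z₄ ∧ z₄ ≠ z₂ ∧ G.Child x y z₄)
    (by rintro _ - _ - rfl h; exact h.symm) (by
      rintro a ha b hb ⟨ha1, a4, a1, a2, a3⟩ ⟨hb1, b4, b1, b2, b3⟩
      rw [mem_farNbrs] at ha hb
      by_contra hab
      obtain ⟨-, ya, -, -, -, hya⟩ := key a ha ha1
      rcases walk a a4 ya b b4 ha hb hab a1 a2 b1 b2 hya with h | h
      · have := cuni h b3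
        subst this
        exact hyc a ha ha1 hya
      · exact ctri a3 b3 h)
  rw [mem_farNbrs] at ha hb hc
  push Not at ha2 hb2 hc2
  obtain ⟨a4, ya, a1, a2, a3, a5⟩ := key a ha ha1
  obtain ⟨b4, yb, b1, b2, b3, b5⟩ := key b hb hb1
  obtain ⟨c4, yc, c1, c2, c3, c5⟩ := key c hc hc1
  have a3' := a3.resolve_left (ha2 ha1 a4 a1 a2)
  have b3' := b3.resolve_left (hb2 hb1 b4 b1 b2)
  have c3' := c3.resolve_left (hc2 hc1 c4 c1 c2)
  have e1 := (walk a a4 ya c c4 ha hc hac a1 a2 c1 c2 a5).resolve_right (fun h => tri a3' h c3')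
  have e2 := (walk b b4 yb c c4 hb hc hbc b1 b2 c1 c2 b5).resolve_right (fun h => tri b3' h c3')
  have := cuni e1 e2
  subst this
  exact hab (ccom a5 b5 ha.symm hb.symm)

/-- A third far neighbour of `z₂` serves as `l₃`; if there is none, `z₂` has a parent and `z₃` is
one step from a child. -/
theorem NoStemOne.card_of_two (hG : G.Sparse) (hF : G.NoStemOne x) {y z₁ z₂ z₃ : V}
    (hy : G.Child x y z₁) (h₁ : G.FarAdj x z₁ z₂) (h₂ : G.FarAdj x z₂ z₃) (hne : z₃ ≠ z₁) :
    (G.farNbrs x z₃).card ≤ 4 := by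
  by_cases hex : ∃ l₃, G.FarAdj x z₂ l₃ ∧ l₃ ≠ z₁ ∧ l₃ ≠ z₃
  · obtain ⟨l₃, hl3, hn1, hn3⟩ := hex
    obtain ⟨l₂, hl2, hnl2⟩ := hG.exists_farAdj hy.2.2 z₂
    refine Finset.card_le_four_of_cover (P := fun t => t = z₂)
      (Q := fun t => G.Child x y t) (R := fun t => G.FarAdj x l₂ t) ?_ ?_ ?_ ?_
    · rintro _ - _ - rfl h; exact h.symm
    · intro u hu v hv h h'
      rw [mem_farNbrs] at hu hv
      exact hG.child_common h h' hu.symm hv.symm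
    · intro u hu v hv h h'
      rw [mem_farNbrs] at hu hv
      refine hG.farAdj_common_eq ?_ h hu h' hv
      rintro rfl
      exact hG.farAdj_tri h₁ h₂ hl2
    · intro t ht
      rw [mem_farNbrs] at ht
      by_cases htn : t = z₂
      · exact .inl htn
      · exact .inr (hF y z₁ z₂ z₃ t l₂ l₃ hy h₁ hl2 h₂ hl3 ht hnl2 hne hn1 hn3 htn)
  · push Not at hex
    obtain ⟨y₂, hy2⟩ := hG.exists_child_of_farAdj (a := z₁) (b := z₃) h₁.2.1 (fun c hc => by
      by_contra! hcon
      exact hcon.2 (hex c hc hcon.1))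
    exact hF.card_of_one hG hy2 h₂

end SimpleGraph

/-! ### Tameness and non-interacting neighbours of `x` -/

namespace SimpleGraph

variable {V : Type*} {G : SimpleGraph V}

/-- `v` is the end of a non-backtracking walk of length one or two, far from `x`, that starts at a
vertex at distance two from `x`. -/
def Near (G : SimpleGraph V) (x v : V) : Prop :=
  (∃ y z, G.Child x y z ∧ G.FarAdj x z v) ∨
    ∃ y z w, G.Child x y z ∧ G.FarAdj x z w ∧ G.FarAdj x w v ∧ v ≠ z

/-- Like `Near`, but with a prescribed neighbour `y` of `x` and allowing the trivial walk. -/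
def Reach (G : SimpleGraph V) (x y v : V) : Prop :=
  G.Child x y v ∨ (∃ z, G.Child x y z ∧ G.FarAdj x z v) ∨
    ∃ z w, G.Child x y z ∧ G.FarAdj x z w ∧ G.FarAdj x w v ∧ v ≠ z

theorem Reach.far {x y v : V} (h : G.Reach x y v) : G.Far x v := by
  rcases h with h | ⟨z, -, h⟩ | ⟨z, w, -, -, h, -⟩
  exacts [h.2.2, h.2.1, h.2.1]

variable [Fintype V] {x : V}

/-- Near vertices have few far neighbours. -/
def Tame (G : SimpleGraph V) (x : V) : Prop := ∀ v, G.Near x v → (G.farNbrs x v).card ≤ 4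

theorem NoStemNine.tame (hG : G.Sparse) (h : G.NoStemNine x) : G.Tame x := by
  rintro v (⟨y, z, h1, h2⟩ | ⟨y, z, w, h1, h2, h3, h4⟩)
  exacts [h.card_of_one hG h1 h2, h.card_of_two hG h1 h2 h3 h4]

theorem NoStemTwo.tame (hG : G.Sparse) (h : G.NoStemTwo x) : G.Tame x := by
  rintro v (⟨y, z, h1, h2⟩ | ⟨y, z, w, h1, h2, h3, h4⟩)
  exacts [h.card_of_one hG h1 h2, h.card_of_two hG h1 h2 h3 h4]

theorem NoStemOne.tame (hG : G.Sparse) (h : G.NoStemOne x) : G.Tame x := by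
  rintro v (⟨y, z, h1, h2⟩ | ⟨y, z, w, h1, h2, h3, h4⟩)
  exacts [h.card_of_one hG h1 h2, h.card_of_two hG h1 h2 h3 h4]

open Classical in
/-- The neighbours `y` of `x` having a child that is joined to `v` by a walk of length at most `n`
all of whose later vertices are near. -/
noncomputable def ancestors (G : SimpleGraph V) (x : V) : ℕ → V → Finset V
  | 0, v => Finset.univ.filter fun y => G.Child x y v
  | n + 1, v => (Finset.univ.filter fun y => G.Child x y v) ∪
      if G.Near x v then (G.farNbrs x v).biUnion (ancestors G x n) else ∅

theorem child_mem_ancestors {y v : V} (h : G.Child x y v) (n : ℕ) : y ∈ G.ancestors x n v := by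
  cases n <;> simp [ancestors, h]

theorem mem_ancestors_succ {y v w : V} {n : ℕ} (hv : G.Near x v) (hw : G.FarAdj x v w)
    (h : y ∈ G.ancestors x n w) : y ∈ G.ancestors x (n + 1) v := by
  simp only [ancestors, if_pos hv, Finset.mem_union, Finset.mem_biUnion]
  exact .inr ⟨w, mem_farNbrs.2 hw, h⟩

theorem Reach.mem_ancestors {y v : V} (h : G.Reach x y v) : y ∈ G.ancestors x 2 v := by
  rcases h with h | ⟨z, h1, h2⟩ | ⟨z, w, h1, h2, h3, h4⟩
  · exact child_mem_ancestors h 2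
  · exact mem_ancestors_succ (.inl ⟨y, z, h1, h2⟩) h2.symm (child_mem_ancestors h1 1)
  · exact mem_ancestors_succ (.inr ⟨y, z, w, h1, h2, h3, h4⟩) h3.symm
      (mem_ancestors_succ (.inl ⟨y, z, h1, h2⟩) h2.symm (child_mem_ancestors h1 0))

theorem Sparse.card_filter_child_le (hG : G.Sparse) (v : V) [DecidablePred fun y => G.Child x y v] :
    (Finset.univ.filter fun y => G.Child x y v).card ≤ 1 :=
  Finset.card_le_one.2 fun a ha b hb => by
    rw [Finset.mem_filter] at ha hb
    exact hG.child_unique ha.2 hb.2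

/-- A vertex has at most one parent, and the walk branches only at near vertices, at most four ways.
Children that are not near may have unbounded degree, which is why walks must not continue from
them. -/
theorem Tame.card_ancestors_succ_le (hG : G.Sparse) (hT : G.Tame x) {n k : ℕ}
    (h : ∀ v, (G.ancestors x n v).card ≤ k) (v : V) :
    (G.ancestors x (n + 1) v).card ≤ 1 + 4 * k := by
  classical
  rw [ancestors]
  refine (Finset.card_union_le _ _).trans (add_le_add (hG.card_filter_child_le v) ?_)
  split_ifs with hv
  · refine (Finset.card_biUnion_le_card_mul _ _ k fun w _ => h w).trans ?_
    exact Nat.mul_le_mul_right k (hT v hv)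
  · simp

theorem Tame.card_ancestors_three_le (hG : G.Sparse) (hT : G.Tame x) (v : V) :
    (G.ancestors x 3 v).card ≤ 85 :=
  hT.card_ancestors_succ_le hG (k := 21) (hT.card_ancestors_succ_le hG (k := 5)
    (hT.card_ancestors_succ_le hG (k := 1) fun v => by
      classical
      rw [ancestors]; exact hG.card_filter_child_le v)) v

/-- Orient a conflict away from a near endpoint; then `y` points to at most `7 * 85 = 595` others,
by counting ancestors of its at most seven vertices. The bound is `3573 = 3 * (2 * 595 + 1)`. -/
theorem Tame.exists_independent (hG : G.Sparse) (hT : G.Tame x) {I : Finset V}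
    (hI : ∀ y ∈ I, G.Adj x y) (S : V → Finset V) (hS : ∀ y ∈ I, ∀ e ∈ S y, G.Reach x y e)
    (hcard : ∀ y ∈ I, (S y).card ≤ 7) (hIcard : 3573 ≤ I.card) :
    ∃ f : Fin 3 → V, Function.Injective f ∧ (∀ i, f i ∈ I) ∧ ∀ i j, i ≠ j →
      (∀ e ∈ S (f j), ¬ G.Adj (f i) e) ∧ ∀ e ∈ S (f i), ∀ e' ∈ S (f j), ¬ G.Adj e e' := by
  classical
  set R : V → V → Prop := fun y y' =>
    ∃ e ∈ S y, G.Adj y' e ∨ (G.Near x e ∧ ∃ e' ∈ S y', G.Adj e e') with hRdef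
  have hR : ∀ y ∈ I, ∀ t ⊆ I, (∀ y' ∈ t, R y y') → t.card ≤ 595 := by
    intro y hy t ht htR
    have hsub : t ⊆ (S y).biUnion (G.ancestors x 3) := by
      intro y' hy'
      obtain ⟨e, he, h⟩ := htR y' hy'
      refine Finset.mem_biUnion.2 ⟨e, he, ?_⟩
      have hef := (hS y hy e he).far
      rcases h with h | ⟨hn, e', he', h⟩
      · exact child_mem_ancestors ⟨hI _ (ht hy'), h, hef⟩ 3
      · have hr := hS _ (ht hy') e' he'
        exact mem_ancestors_succ hn ⟨hef, hr.far, h⟩ hr.mem_ancestors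
    refine (Finset.card_le_card hsub).trans ((Finset.card_biUnion_le_card_mul _ _ 85
      fun v _ => hT.card_ancestors_three_le hG v).trans ?_)
    have := hcard y hy
    omega
  obtain ⟨f, hf, hfI, hfR⟩ := Finset.exists_injective_pairwise_not_rel R 595 3 I hR hIcard
  refine ⟨f, hf, hfI, fun i j hij => ⟨fun e he h => ?_, fun e he e' he' h => ?_⟩⟩
  · exact hfR j i hij.symm ⟨e, he, .inl h⟩
  -- A reached vertex that is not near is a child, and then its neighbour `e'` is near.
  · by_cases hn : G.Near x e
    · exact hfR i j hij ⟨e, he, .inr ⟨hn, e', he', h⟩⟩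
    · have hr := hS _ (hfI i) e he
      have hn' : G.Near x e' := by
        rcases hr with hr | ⟨z, h1, h2⟩ | ⟨z, w, h1, h2, h3, h4⟩
        · exact .inl ⟨_, e, hr, hr.2.2, (hS _ (hfI j) e' he').far, h⟩
        · exact absurd (.inl ⟨_, z, h1, h2⟩) hn
        · exact absurd (.inr ⟨_, z, w, h1, h2, h3, h4⟩) hn
      exact hfR j i hij.symm ⟨e', he', .inr ⟨hn', e, he, h.symm⟩⟩

end SimpleGraph

/-! ### Gadgets and the three trees in the tame case -/

namespace SimpleGraph

variable {V : Type*} {G : SimpleGraph V} {x : V}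

/-- Two children `z`, `z'` of `y`, two legs `z a a'` and `z b b'`, and a leg `z' w`. -/
structure Gadget (G : SimpleGraph V) (x y z z' a b a' b' w : V) : Prop where
  child : G.Child x y z
  child' : G.Child x y z'
  z_ne_z' : z ≠ z'
  adj_a : G.FarAdj x z a
  adj_b : G.FarAdj x z b
  a_ne_b : a ≠ b
  adj_a' : G.FarAdj x a a'
  adj_b' : G.FarAdj x b b'
  a'_ne : a' ≠ z
  b'_ne : b' ≠ z
  adj_w : G.FarAdj x z' w
  not_a_w : ¬ G.Adj a w
  alternative : G.Adj a' b' → ¬ G.Adj a' z'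

/-- As `z'` has two candidates for `w` and a vertex `a` is adjacent to at most one of them,
`not_a_w` can be met. Exchanging the legs at `z` secures `alternative`, since `a' b' z'` is not a
triangle. -/
theorem Sparse.exists_gadget (hG : G.Sparse) {y : V} (hy : G.Adj x y) :
    ∃ z z' a b a' b' w, G.Gadget x y z z' a b a' b' w := by
  have child : ∀ {z}, G.Adj y z → z ≠ x → G.Child x y z := fun h h' =>
    ⟨hy, h, hG.far_of_adj hy h h'⟩
  have grand : ∀ {z w}, G.Child x y z → G.Adj z w → w ≠ y → G.FarAdj x z w := fun h h' h'' =>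
    ⟨h.2.2, hG.far_of_adj_adj hy h.2.1 h.2.2.1 h' h'', h'⟩
  obtain ⟨z, h1, h2, -⟩ := hG.third y x x
  obtain ⟨z', h3, h4, h5⟩ := hG.third y x z
  have hz := child h1 h2
  have hz' := child h3 h4
  obtain ⟨a, a1, a2, -⟩ := hG.third z y y
  obtain ⟨b, b1, b2, b3⟩ := hG.third z y a
  have ha := grand hz a1 a2
  have hb := grand hz b1 b2
  obtain ⟨a', a3, a4⟩ := hG.exists_farAdj ha.2.1 z
  obtain ⟨b', b4, b5⟩ := hG.exists_farAdj hb.2.1 z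
  have leg : ∀ a, G.FarAdj x z a → ∃ w, G.FarAdj x z' w ∧ ¬ G.Adj a w := by
    intro a ha
    obtain ⟨w, w1, w2, -⟩ := hG.third z' y y
    obtain ⟨v, v1, v2, v3⟩ := hG.third z' y w
    by_cases h : G.Adj a w
    · refine ⟨v, grand hz' v1 v2, fun h' => v3 (hG.common_eq ?_ v1 h' w1 h)⟩
      rintro rfl
      exact hG.child_not_adj hz hz' ha
    · exact ⟨w, grand hz' w1 w2, h⟩
  by_cases h : G.Adj a' b' ∧ G.Adj a' z'
  · obtain ⟨w, w1, w2⟩ := leg b hb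
    exact ⟨z, z', b, a, b', a', w, hz, hz', h5.symm, hb, ha, b3, b4, a3, b5, a4, w1, w2,
      fun h' h'' => hG.tri h' h.2 h''⟩
  · obtain ⟨w, w1, w2⟩ := leg a ha
    exact ⟨z, z', a, b, a', b', w, hz, hz', h5.symm, ha, hb, b3.symm, a3, b4, a4, b5, w1, w2,
      fun h' h'' => h ⟨h', h''⟩⟩

theorem Far.ne_of_adj {u v : V} (h : G.Far x v) (h' : G.Adj x u) : u ≠ v := by
  rintro rfl; exact h.2 h'

variable [Fintype V]

theorem Tame.exists_gadgets (hG : G.Sparse) (hT : G.Tame x) {I : Finset V}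
    (hI : ∀ y ∈ I, G.Adj x y) {P : V → V → Prop} 
    (hP : ∀ y ∈ I, ∃ z z' a b a' b' w, G.Gadget x y z z' a b a' b' w ∧ P a' b')
    (hIcard : 3573 ≤ I.card) :
    ∃ y z z' a b a' b' w : Fin 3 → V, Function.Injective y ∧ (∀ i, G.Adj x (y i)) ∧
      (∀ i, G.Gadget x (y i) (z i) (z' i) (a i) (b i) (a' i) (b' i) (w i)) ∧
      (∀ i, P (a' i) (b' i)) ∧
      (∀ i j, i ≠ j → ∀ u ∈ [y i, z i, z' i, a i, b i, a' i, b' i, w i],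
        ∀ v ∈ [z j, z' j, a j, b j, a' j, b' j, w j], ¬ G.Adj u v) := by
  classical
  choose! z z' a b a' b' w h hp using hP
  have hS : ∀ y ∈ I, ∀ e ∈ [z y, z' y, a y, b y, a' y, b' y, w y].toFinset, G.Reach x y e := by
    intro y hy e he
    have g := h y hy
    simp only [List.mem_toFinset, List.mem_cons, List.not_mem_nil, or_false] at he
    rcases he with rfl | rfl | rfl | rfl | rfl | rfl | rfl
    · exact .inl g.child
    · exact .inl g.child'
    · exact .inr (.inl ⟨_, g.child, g.adj_a⟩)
    · exact .inr (.inl ⟨_, g.child, g.adj_b⟩)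
    · exact .inr (.inr ⟨_, _, g.child, g.adj_a, g.adj_a', g.a'_ne⟩)
    · exact .inr (.inr ⟨_, _, g.child, g.adj_b, g.adj_b', g.b'_ne⟩)
    · exact .inr (.inl ⟨_, g.child', g.adj_w⟩)
  obtain ⟨f, hf, hfI, hfS⟩ := hT.exists_independent hG hI _ hS
    (fun y _ => List.toFinset_card_le _) hIcard
  refine ⟨f, z ∘ f, z' ∘ f, a ∘ f, b ∘ f, a' ∘ f, b' ∘ f, w ∘ f, hf, fun i => hI _ (hfI i),
    fun i => h _ (hfI i), fun i => hp _ (hfI i), fun i j hij u hu v hv => ?_⟩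
  rcases List.mem_cons.1 hu with rfl | hu
  · exact (hfS i j hij).1 v (List.mem_toFinset.2 hv)
  · exact (hfS i j hij).2 u (List.mem_toFinset.2 hu) v (List.mem_toFinset.2 hv)

/-- The centre `u₃` is `y 0`, with legs into its two children; the path goes on through `x` into the
second gadget, and `y 2` is the pendant vertex at `x`. -/
theorem Tame.treeT82_isIndContained (hG : G.Sparse) (hT : G.Tame x) {I : Finset V}
    (hI : ∀ y ∈ I, G.Adj x y) (hIcard : 3573 ≤ I.card) : treeT82.IsIndContained G := by
  obtain ⟨y, z, z', a, b, a', b', w, hinj, hy, g, -, cross⟩ :=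
    hT.exists_gadgets hG hI (P := fun _ _ => True)
      (fun y hy => by simpa using hG.exists_gadget (hI y hy)) hIcard
  have c₀ := cross 0 1 (by decide)
  have c₁ := cross 1 0 (by decide)
  have c₂ := cross 2 0 (by decide)
  have c₃ := cross 2 1 (by decide)
  have n : y 0 ≠ y 1 := hinj.ne (by decide)
  have n' : y 0 ≠ y 2 := hinj.ne (by decide)
  have n'' : y 1 ≠ y 2 := hinj.ne (by decide)
  have g₀ := g 0
  have g₁ := g 1
  refine SimpleGraph.treeT82_isIndContained hG (u₁ := w 0) (u₂ := z' 0) (u₃ := y 0) (u₄ := x)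
    (u₅ := y 1) (u₆ := z 1) (u₇ := a 1) (u₈ := a' 1) (v := z 0) (v' := a 0) (w := y 2) ?_ ?_ ?_
  · exact ⟨g₀.adj_w.adj.symm, g₀.child'.2.1.symm, (hy 0).symm, hy 1, g₁.child.2.1, g₁.adj_a.adj,
      g₁.adj_a'.adj, g₀.child.2.1, g₀.adj_a.adj, hy 2⟩
  · exact ⟨(g₀.adj_w.2.1.ne_of_adj (hy 0)).symm, g₀.child'.2.2.1, g₀.z_ne_z'.symm, n,
      g₀.adj_a.2.1.ne_of_adj (hy 0), n', g₁.child.2.2.1.symm, g₀.child.2.2.1.symm,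
      g₁.adj_a.2.1.ne_of_adj (hy 1), n'', g₁.a'_ne.symm⟩
  · have := g₁.adj_a'.2.1.2
    have := g₀.not_a_w
    simp only [List.forall_mem_cons, List.not_mem_nil, false_imp_iff, implies_true, and_true]
    and_intros <;> first
      | assumption
      | (rw [SimpleGraph.adj_comm]; assumption)
      | (refine c₀ _ ?_ _ ?_ <;> simp <;> done)
      | (refine c₁ _ ?_ _ ?_ <;> simp <;> done)
      | (refine fun h => c₀ _ ?_ _ ?_ h.symm <;> simp <;> done)
      | (refine fun h => c₁ _ ?_ _ ?_ h.symm <;> simp <;> done)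
      | (refine fun h => c₂ _ ?_ _ ?_ h.symm <;> simp <;> done)
      | (refine fun h => c₃ _ ?_ _ ?_ h.symm <;> simp)

/-- The centre is `z 0`, whose legs `z a a'` and `z b b'` are induced because `a'` and `b'` are not
adjacent. -/
theorem Tame.treeT81_isIndContained_of_not_adj (hG : G.Sparse) (hT : G.Tame x) {I : Finset V}
    (hI : ∀ y ∈ I, G.Adj x y)
    (hP : ∀ y ∈ I, ∃ z z' a b a' b' w, G.Gadget x y z z' a b a' b' w ∧ ¬ G.Adj a' b')
    (hIcard : 3573 ≤ I.card) : treeT81.IsIndContained G := by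
  obtain ⟨y, z, z', a, b, a', b', w, hinj, hy, g, hp, cross⟩ := hT.exists_gadgets hG hI hP hIcard
  have c₀ := cross 0 1 (by decide)
  have c₁ := cross 1 0 (by decide)
  have c₂ := cross 2 0 (by decide)
  have c₃ := cross 2 1 (by decide)
  have n : y 0 ≠ y 1 := hinj.ne (by decide)
  have n' : y 0 ≠ y 2 := hinj.ne (by decide)
  have n'' : y 1 ≠ y 2 := hinj.ne (by decide)
  have g₀ := g 0
  have g₁ := g 1
  have hp₀ := hp 0
  refine treeT81_isIndContained hG (u₁ := a' 0) (u₂ := a 0) (u₃ := z 0) (u₄ := y 0)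
    (u₅ := x) (u₆ := y 1) (u₇ := z 1) (u₈ := a 1) (v := b 0) (v' := b' 0) (w₅ := y 2)
    (w₆ := z' 1) ?_ ?_ ?_
  · exact ⟨g₀.adj_a'.adj.symm, g₀.adj_a.adj.symm, g₀.child.2.1.symm, (hy 0).symm, hy 1,
      g₁.child.2.1, g₁.adj_a.adj, g₀.adj_b.adj, g₀.adj_b'.adj, hy 2, g₁.child'.2.1⟩
  · exact ⟨g₀.a'_ne, (g₀.adj_a.2.1.ne_of_adj (hy 0)).symm, g₀.a_ne_b, g₀.child.2.2.1,
      g₀.b'_ne.symm, n, g₀.adj_b.2.1.ne_of_adj (hy 0), n', g₁.child.2.2.1.symm,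
      g₁.child'.2.2.1.symm, g₁.adj_a.2.1.ne_of_adj (hy 1), n'', g₁.z_ne_z'⟩
  · have := g₀.adj_a'.2.1.2
    have := g₀.adj_b'.2.1.2
    simp only [List.forall_mem_cons, List.not_mem_nil, false_imp_iff, implies_true, and_true]
    and_intros <;> first
      | assumption
      | (rw [SimpleGraph.adj_comm]; assumption)
      | (refine c₀ _ ?_ _ ?_ <;> simp <;> done)
      | (refine c₁ _ ?_ _ ?_ <;> simp <;> done)
      | (refine fun h => c₀ _ ?_ _ ?_ h.symm <;> simp <;> done)
      | (refine fun h => c₁ _ ?_ _ ?_ h.symm <;> simp <;> done)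
      | (refine fun h => c₂ _ ?_ _ ?_ h.symm <;> simp <;> done)
      | (refine fun h => c₃ _ ?_ _ ?_ h.symm <;> simp)

/-- Now the centre is `y 0`. Adjacency of `a'` and `b'` matters only through `alternative`, which
keeps `u₈ = a' 1` away from `w₅ = z' 1`. -/
theorem Tame.treeT81_isIndContained_of_adj (hG : G.Sparse) (hT : G.Tame x) {I : Finset V}
    (hI : ∀ y ∈ I, G.Adj x y)
    (hP : ∀ y ∈ I, ∃ z z' a b a' b' w, G.Gadget x y z z' a b a' b' w ∧ G.Adj a' b')
    (hIcard : 3573 ≤ I.card) : treeT81.IsIndContained G := by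
  obtain ⟨y, z, z', a, b, a', b', w, hinj, hy, g, hp, cross⟩ := hT.exists_gadgets hG hI hP hIcard
  have c₀ := cross 0 1 (by decide)
  have c₁ := cross 1 0 (by decide)
  have n : y 0 ≠ y 1 := hinj.ne (by decide)
  have g₀ := g 0
  have g₁ := g 1
  have hp₁ := hp 1
  refine treeT81_isIndContained hG (u₁ := w 0) (u₂ := z' 0) (u₃ := y 0) (u₄ := x)
    (u₅ := y 1) (u₆ := z 1) (u₇ := a 1) (u₈ := a' 1) (v := z 0) (v' := a 0) (w₅ := z' 1)
    (w₆ := b 1) ?_ ?_ ?_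
  · exact ⟨g₀.adj_w.adj.symm, g₀.child'.2.1.symm, (hy 0).symm, hy 1, g₁.child.2.1, g₁.adj_a.adj,
      g₁.adj_a'.adj, g₀.child.2.1, g₀.adj_a.adj, g₁.child'.2.1, g₁.adj_b.adj⟩
  · exact ⟨(g₀.adj_w.2.1.ne_of_adj (hy 0)).symm, g₀.child'.2.2.1, g₀.z_ne_z'.symm, n,
      g₀.adj_a.2.1.ne_of_adj (hy 0), g₁.child.2.2.1.symm, g₀.child.2.2.1.symm,
      g₁.child'.2.2.1.symm, g₁.adj_a.2.1.ne_of_adj (hy 1), g₁.adj_b.2.1.ne_of_adj (hy 1),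
      g₁.a'_ne.symm, g₁.z_ne_z', g₁.a_ne_b⟩
  · have := g₁.adj_a'.2.1.2
    have := g₀.not_a_w
    have := g₁.alternative hp₁
    simp only [List.forall_mem_cons, List.not_mem_nil, false_imp_iff, implies_true, and_true]
    and_intros <;> first
      | assumption
      | (rw [SimpleGraph.adj_comm]; assumption)
      | (refine c₀ _ ?_ _ ?_ <;> simp <;> done)
      | (refine c₁ _ ?_ _ ?_ <;> simp <;> done)
      | (refine fun h => c₀ _ ?_ _ ?_ h.symm <;> simp <;> done)
      | (refine fun h => c₁ _ ?_ _ ?_ h.symm <;> simp)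

theorem Tame.treeT9_isIndContained_of_not_adj (hG : G.Sparse) (hT : G.Tame x) {I : Finset V}
    (hI : ∀ y ∈ I, G.Adj x y)
    (hP : ∀ y ∈ I, ∃ z z' a b a' b' w, G.Gadget x y z z' a b a' b' w ∧ ¬ G.Adj a' b')
    (hIcard : 3573 ≤ I.card) : treeT9.IsIndContained G := by
  obtain ⟨y, z, z', a, b, a', b', w, hinj, hy, g, hp, cross⟩ := hT.exists_gadgets hG hI hP hIcard
  have c₀ := cross 0 1 (by decide)
  have c₁ := cross 1 0 (by decide)
  have n : y 0 ≠ y 1 := hinj.ne (by decide)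
  have g₀ := g 0
  have g₁ := g 1
  have hp₀ := hp 0
  refine treeT9_isIndContained hG (u₁ := a' 0) (u₂ := a 0) (u₃ := z 0) (u₄ := y 0)
    (u₅ := x) (u₆ := y 1) (u₇ := z 1) (u₈ := a 1) (u₉ := a' 1) (v := b 0) (v' := b' 0) ?_ ?_ ?_
  · exact ⟨g₀.adj_a'.adj.symm, g₀.adj_a.adj.symm, g₀.child.2.1.symm, (hy 0).symm, hy 1,
      g₁.child.2.1, g₁.adj_a.adj, g₁.adj_a'.adj, g₀.adj_b.adj, g₀.adj_b'.adj⟩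
  · exact ⟨g₀.a'_ne, (g₀.adj_a.2.1.ne_of_adj (hy 0)).symm, g₀.a_ne_b, g₀.child.2.2.1,
      g₀.b'_ne.symm, n, g₀.adj_b.2.1.ne_of_adj (hy 0), g₁.child.2.2.1.symm,
      g₁.adj_a.2.1.ne_of_adj (hy 1), g₁.a'_ne.symm⟩
  · have := g₀.adj_a'.2.1.2
    have := g₀.adj_b'.2.1.2
    have := g₁.adj_a'.2.1.2
    simp only [List.forall_mem_cons, List.not_mem_nil, false_imp_iff, implies_true, and_true]
    and_intros <;> first
      | assumption
      | (rw [SimpleGraph.adj_comm]; assumption)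
      | (refine c₀ _ ?_ _ ?_ <;> simp <;> done)
      | (refine c₁ _ ?_ _ ?_ <;> simp <;> done)
      | (refine fun h => c₀ _ ?_ _ ?_ h.symm <;> simp <;> done)
      | (refine fun h => c₁ _ ?_ _ ?_ h.symm <;> simp)

/-- The edge `a' b'` lengthens the path in the second gadget by one vertex. -/
theorem Tame.treeT9_isIndContained_of_adj (hG : G.Sparse) (hT : G.Tame x) {I : Finset V}
    (hI : ∀ y ∈ I, G.Adj x y)
    (hP : ∀ y ∈ I, ∃ z z' a b a' b' w, G.Gadget x y z z' a b a' b' w ∧ G.Adj a' b')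
    (hIcard : 3573 ≤ I.card) : treeT9.IsIndContained G := by
  obtain ⟨y, z, z', a, b, a', b', w, hinj, hy, g, hp, cross⟩ := hT.exists_gadgets hG hI hP hIcard
  have c₀ := cross 0 1 (by decide)
  have c₁ := cross 1 0 (by decide)
  have n : y 0 ≠ y 1 := hinj.ne (by decide)
  have g₀ := g 0
  have g₁ := g 1
  have hp₁ := hp 1
  refine treeT9_isIndContained hG (u₁ := w 0) (u₂ := z' 0) (u₃ := y 0) (u₄ := x)
    (u₅ := y 1) (u₆ := z 1) (u₇ := a 1) (u₈ := a' 1) (u₉ := b' 1) (v := z 0) (v' := a 0) ?_ ?_ ?_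
  · exact ⟨g₀.adj_w.adj.symm, g₀.child'.2.1.symm, (hy 0).symm, hy 1, g₁.child.2.1, g₁.adj_a.adj,
      g₁.adj_a'.adj, hp₁, g₀.child.2.1, g₀.adj_a.adj⟩
  · refine ⟨(g₀.adj_w.2.1.ne_of_adj (hy 0)).symm, g₀.child'.2.2.1, g₀.z_ne_z'.symm, n,
      g₀.adj_a.2.1.ne_of_adj (hy 0), g₁.child.2.2.1.symm, g₀.child.2.2.1.symm,
      g₁.adj_a.2.1.ne_of_adj (hy 1), g₁.a'_ne.symm, ?_⟩
    exact fun h => hG.farAdj_tri g₁.adj_a (h ▸ g₁.adj_b'.symm) g₁.adj_b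
  · have := g₁.adj_a'.2.1.2
    have := g₁.adj_b'.2.1.2
    have := g₀.not_a_w
    -- The chord `y b'` has distance four along `y z a a' b'`, but it would close a 4-cycle with `y
    -- z b b'`.
    have := hG.sq g₁.child.2.1 g₁.adj_b.adj g₁.adj_b'.adj (g₁.adj_b.2.1.ne_of_adj (hy 1))
      g₁.b'_ne.symm
    simp only [List.forall_mem_cons, List.not_mem_nil, false_imp_iff, implies_true, and_true]
    and_intros <;> first
      | assumption
      | (rw [SimpleGraph.adj_comm]; assumption)
      | (refine c₀ _ ?_ _ ?_ <;> simp <;> done)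
      | (refine c₁ _ ?_ _ ?_ <;> simp <;> done)
      | (refine fun h => c₀ _ ?_ _ ?_ h.symm <;> simp <;> done)
      | (refine fun h => c₁ _ ?_ _ ?_ h.symm <;> simp)

/-- Half of `7146 = 2 * 3573` neighbours agree on whether some gadget has `a'` and `b'`
non-adjacent. -/
theorem Tame.isIndContained (hG : G.Sparse) (hT : G.Tame x) {I : Finset V}
    (hI : ∀ y ∈ I, G.Adj x y) (hIcard : 7146 ≤ I.card) :
    treeT81.IsIndContained G ∧ treeT82.IsIndContained G ∧ treeT9.IsIndContained G := by
  have split : ∀ P : V → Prop, ∃ J ⊆ I, 3573 ≤ J.card ∧ ((∀ y ∈ J, P y) ∨ ∀ y ∈ J, ¬ P y) := by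
    classical
    intro P
    have hsum := I.card_filter_add_card_filter_not P
    rcases le_total 3573 (I.filter P).card with h | h
    · exact ⟨_, Finset.filter_subset _ _, h, .inl fun y hy => (Finset.mem_filter.1 hy).2⟩
    · exact ⟨I.filter fun y => ¬ P y, Finset.filter_subset _ _, by omega,
        .inr fun y hy => (Finset.mem_filter.1 hy).2⟩
  obtain ⟨J, hJI, hJ, h⟩ := split fun y =>
    ∃ z z' a b a' b' w, G.Gadget x y z z' a b a' b' w ∧ ¬ G.Adj a' b'
  have hJ' : ∀ y ∈ J, G.Adj x y := fun y hy => hI y (hJI hy)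
  rcases h with h | h
  · exact ⟨hT.treeT81_isIndContained_of_not_adj hG hJ' h hJ,
      hT.treeT82_isIndContained hG hJ' hJ, hT.treeT9_isIndContained_of_not_adj hG hJ' h hJ⟩
  · have h' : ∀ y ∈ J, ∃ z z' a b a' b' w, G.Gadget x y z z' a b a' b' w ∧ G.Adj a' b' := by
      intro y hy
      obtain ⟨z, z', a, b, a', b', w, hg⟩ := hG.exists_gadget (hJ' y hy)
      by_contra hcon
      exact h y hy ⟨z, z', a, b, a', b', w, hg, fun h' => hcon ⟨z, z', a, b, a', b', w, hg, h'⟩⟩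
    exact ⟨hT.treeT81_isIndContained_of_adj hG hJ' h' hJ,
      hT.treeT82_isIndContained hG hJ' hJ, hT.treeT9_isIndContained_of_adj hG hJ' h' hJ⟩

end SimpleGraph

/-! ### Avoiding legs and the exclusion of stems -/

namespace SimpleGraph

variable {V : Type*} {G : SimpleGraph V} {x : V}

/-- Each `y ∈ I` has two distinct children, one adjacent to `p` and one adjacent to `q`. -/
structure Theta (G : SimpleGraph V) (x p q : V) (I : Finset V) : Prop where
  far_p : G.Far x p
  far_q : G.Far x q
  ne : p ≠ q
  legs : ∀ y ∈ I, ∃ z z', G.Child x y z ∧ G.Child x y z' ∧ z ≠ z' ∧ G.Adj z p ∧ G.Adj z' q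

variable [Fintype V]

/-- A neighbour `y` of `x` is useless only if it is `y₀`, is the parent of a vertex of `S`, or has
all its children adjacent to `S`. In the last case two children see distinct `p`, `q` in `S` (no
4-cycle), so `y` lies in one of at most 36 thetas. With at most two good ones the total is at most
`2 + 1 + 6 + 36 * M`. -/
theorem Sparse.exists_legs (hG : G.Sparse) {I : Finset V} (hI : ∀ y ∈ I, G.Adj x y)
    {S : Finset V} (hS : ∀ s ∈ S, G.Far x s) (hcard : S.card ≤ 6) (y₀ : V) {M : ℕ}
    (hM : 36 * M + 10 ≤ I.card) (hθ : ∀ p q J, G.Theta x p q J → J.card ≤ M) :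
    ∃ y₁ z₁ y₂ z₂, G.Child x y₁ z₁ ∧ G.Child x y₂ z₂ ∧ y₁ ≠ y₂ ∧ y₀ ≠ y₁ ∧ y₀ ≠ y₂ ∧
      ¬ G.Adj z₁ z₂ ∧ ∀ s ∈ S, ¬ G.Adj y₁ s ∧ ¬ G.Adj z₁ s ∧ ¬ G.Adj y₂ s ∧ ¬ G.Adj z₂ s := by
  classical
  set good : V → Prop := fun y => y₀ ≠ y ∧ (∀ s ∈ S, ¬ G.Adj y s) ∧
    ∃ z, G.Child x y z ∧ ∀ s ∈ S, ¬ G.Adj z s with hgood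
  by_cases h3 : 2 < (I.filter good).card
  · obtain ⟨a, ha, b, hb, c, hc, hab, hac, hbc⟩ := Finset.two_lt_card.1 h3
    rw [Finset.mem_filter] at ha hb hc
    obtain ⟨-, a1, a2, za, a3, a4⟩ := ha
    obtain ⟨-, b1, b2, zb, b3, b4⟩ := hb
    obtain ⟨-, c1, c2, zc, c3, c4⟩ := hc
    -- Among the chosen children of three good neighbours two are non-adjacent, there being no
    -- triangle.
    by_cases hz : G.Adj za zb
    · by_cases hz' : G.Adj za zc
      · exact ⟨b, zb, c, zc, b3, c3, hbc, b1, c1, hG.tri hz.symm hz',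
          fun s hs => ⟨b2 s hs, b4 s hs, c2 s hs, c4 s hs⟩⟩
      · exact ⟨a, za, c, zc, a3, c3, hac, a1, c1, hz',
          fun s hs => ⟨a2 s hs, a4 s hs, c2 s hs, c4 s hs⟩⟩
    · exact ⟨a, za, b, zb, a3, b3, hab, a1, b1, hz,
        fun s hs => ⟨a2 s hs, a4 s hs, b2 s hs, b4 s hs⟩⟩
  exfalso
  set T : V × V → Finset V := fun pq => I.filter fun y => pq.1 ≠ pq.2 ∧
    ∃ z z', G.Child x y z ∧ G.Child x y z' ∧ z ≠ z' ∧ G.Adj z pq.1 ∧ G.Adj z' pq.2 with hT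
  have hTcard : ∀ pq ∈ S ×ˢ S, (T pq).card ≤ M := by
    intro pq hpq
    rw [Finset.mem_product] at hpq
    by_cases hne : pq.1 = pq.2
    · simp [hT, hne]
    · exact hθ pq.1 pq.2 _ ⟨hS _ hpq.1, hS _ hpq.2, hne, fun y hy => (Finset.mem_filter.1 hy).2.2⟩
  have hsub : I ⊆ I.filter good ∪ ({y₀} ∪ (S.biUnion (fun s => Finset.univ.filter
      fun y => G.Child x y s) ∪ (S ×ˢ S).biUnion T)) := by
    intro y hy
    have hxy := hI y hy
    by_contra hcon
    simp only [Finset.mem_union, Finset.mem_filter, Finset.mem_singleton, Finset.mem_biUnion,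
      Finset.mem_univ, true_and, not_or, hy, hT] at hcon
    obtain ⟨h1, h2, h4, h5⟩ := hcon
    have hys : ∀ s ∈ S, ¬ G.Adj y s := fun s hs h => h4 ⟨s, hs, hxy, h, hS s hs⟩
    have hz : ∀ z, G.Child x y z → ∃ s ∈ S, G.Adj z s := by
      intro z hz
      by_contra! hcon
      exact h1 ⟨Ne.symm h2, hys, z, hz, hcon⟩
    obtain ⟨z, hz1, hz2, -⟩ := hG.third y x x
    have hzc : G.Child x y z := ⟨hxy, hz1, hG.far_of_adj hxy hz1 hz2⟩
    obtain ⟨z', hz'c, hne⟩ := hG.exists_sibling hzc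
    obtain ⟨p, hp, hzp⟩ := hz z hzc
    obtain ⟨q, hq, hzq⟩ := hz z' hz'c
    refine h5 ⟨(p, q), Finset.mem_product.2 ⟨hp, hq⟩, ?_, z, z', hzc, hz'c, hne.symm, hzp, hzq⟩
    rintro h
    simp only at h
    subst h
    exact hG.sq hz1 hzp hzq.symm (fun h => (hS p hp).2 (h ▸ hxy)) hne.symm hz'c.2.1
  have e0 := Finset.card_le_card hsub
  have e1 := Finset.card_union_le (I.filter good) ({y₀} ∪ (S.biUnion (fun s => Finset.univ.filter
      fun y => G.Child x y s) ∪ (S ×ˢ S).biUnion T))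
  have e2 := Finset.card_union_le {y₀} (S.biUnion (fun s => Finset.univ.filter
      fun y => G.Child x y s) ∪ (S ×ˢ S).biUnion T)
  have e3 := Finset.card_union_le (S.biUnion (fun s => Finset.univ.filter
      fun y => G.Child x y s)) ((S ×ˢ S).biUnion T)
  have e4 := Finset.card_biUnion_le_card_mul S (fun s => Finset.univ.filter
      fun y => G.Child x y s) 1 fun s _ => hG.card_filter_child_le s
  have e5 := Finset.card_biUnion_le_card_mul (S ×ˢ S) T M hTcard
  have e6 : (S ×ˢ S).card * M ≤ 36 * M :=
    Nat.mul_le_mul_right M (by rw [Finset.card_product]; exact Nat.mul_le_mul hcard hcard)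
  rw [Finset.card_singleton] at e2
  omega

theorem Sparse.exists_legs_list (hG : G.Sparse) {I : Finset V} (hI : ∀ y ∈ I, G.Adj x y)
    (S : List V) (hS : ∀ s ∈ S, G.Far x s) (hcard : S.length ≤ 6) (y₀ : V) {M : ℕ}
    (hM : 36 * M + 10 ≤ I.card) (hθ : ∀ p q J, G.Theta x p q J → J.card ≤ M) :
    ∃ y₁ z₁ y₂ z₂, G.Child x y₁ z₁ ∧ G.Child x y₂ z₂ ∧ y₁ ≠ y₂ ∧ y₀ ≠ y₁ ∧ y₀ ≠ y₂ ∧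
      ¬ G.Adj z₁ z₂ ∧ ∀ s ∈ S, ¬ G.Adj y₁ s ∧ ¬ G.Adj z₁ s ∧ ¬ G.Adj y₂ s ∧ ¬ G.Adj z₂ s := by
  classical
  simpa using hG.exists_legs hI (S := S.toFinset) (by simpa using hS)
    ((List.toFinset_card_le S).trans hcard) y₀ hM hθ

/-- A stem without chords, together with two legs at `x` avoiding it, is an induced tree. The other
two exclusions work alike. -/
theorem Sparse.noStemTwo (hG : G.Sparse) {I : Finset V} (hI : ∀ y ∈ I, G.Adj x y) {M : ℕ}
    (hM : 36 * M + 10 ≤ I.card) (hθ : ∀ p q J, G.Theta x p q J → J.card ≤ M)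
    (hT : ¬ treeT82.IsIndContained G) : G.NoStemTwo x := by
  intro y z₁ z₂ z₃ z₄ l hy h₁ h₂ h₃ hl n₁ n₂ n₃
  by_contra! hcon
  obtain ⟨m₁, m₂, m₃⟩ := hcon
  refine hT ?_
  obtain ⟨ya, za, yb, zb, ca, cb, hab, ha, hb, hz, hcross⟩ :=
    hG.exists_legs_list hI [z₁, z₂, z₃, z₄, l] (by
      simp only [List.forall_mem_cons, List.not_mem_nil, false_imp_iff, implies_true, and_true]
      exact ⟨h₁.1, h₁.2.1, h₃.1, h₃.2.1, hl.2.2⟩) (by simp) y hM hθ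
  simp only [List.forall_mem_cons, List.not_mem_nil, false_imp_iff, implies_true, and_true]
    at hcross
  obtain ⟨⟨_, _, _, _⟩, ⟨_, _, _, _⟩, ⟨_, _, _, _⟩, ⟨_, _, _, _⟩, _, _, _, _⟩ := hcross
  refine treeT82_isIndContained hG (u₁ := za) (u₂ := ya) (u₃ := x) (u₄ := y) (u₅ := z₁)
    (u₆ := z₂) (u₇ := z₃) (u₈ := z₄) (v := yb) (v' := zb) (w := l) ?_ ?_ ?_
  · exact ⟨ca.2.1.symm, ca.1.symm, hy.1, hy.2.1, h₁.adj, h₂.adj, h₃.adj, cb.1, cb.2.1, hl.2.1⟩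
  · exact ⟨ca.2.2.1, ha.symm, hab, hy.2.2.1.symm, cb.2.2.1.symm, hl.2.2.1.symm,
      h₁.2.1.ne_of_adj hy.1, hb, n₁.symm, n₃.symm, n₂.symm⟩
  · have := h₂.2.1.2
    have := h₃.2.1.2
    have : ¬ G.Adj y z₄ := fun h => m₁ ⟨hy.1, h, h₃.2.1⟩
    have : ¬ G.Adj l z₃ := fun h => m₂ ⟨hl.2.2, h₃.1, h⟩
    have : ¬ G.Adj l z₄ := fun h => m₃ ⟨hl.2.2, h₃.2.1, h⟩
    simp only [List.forall_mem_cons, List.not_mem_nil, false_imp_iff, implies_true, and_true]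
    and_intros <;> first | assumption | (rw [SimpleGraph.adj_comm]; assumption)

theorem Sparse.noStemOne (hG : G.Sparse) {I : Finset V} (hI : ∀ y ∈ I, G.Adj x y) {M : ℕ}
    (hM : 36 * M + 10 ≤ I.card) (hθ : ∀ p q J, G.Theta x p q J → J.card ≤ M)
    (hT : ¬ treeT81.IsIndContained G) : G.NoStemOne x := by
  intro y z₁ z₂ z₃ z₄ l₂ l₃ hy h₁ hl₂ h₂ hl₃ h₃ n₁ n₂ n₃ n₄ n₅
  by_contra! hcon
  obtain ⟨m₁, m₂⟩ := hcon
  refine hT ?_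
  obtain ⟨ya, za, yb, zb, ca, cb, hab, ha, hb, hz, hcross⟩ :=
    hG.exists_legs_list hI [z₁, z₂, z₃, z₄, l₂, l₃] (by
      simp only [List.forall_mem_cons, List.not_mem_nil, false_imp_iff, implies_true, and_true]
      exact ⟨h₁.1, h₁.2.1, h₃.1, h₃.2.1, hl₂.2.1, hl₃.2.1⟩) (by simp) y hM hθ
  simp only [List.forall_mem_cons, List.not_mem_nil, false_imp_iff, implies_true, and_true]
    at hcross
  obtain ⟨⟨_, _, _, _⟩, ⟨_, _, _, _⟩, ⟨_, _, _, _⟩, ⟨_, _, _, _⟩, ⟨_, _, _, _⟩, _, _, _, _⟩ :=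
    hcross
  refine treeT81_isIndContained hG (u₁ := za) (u₂ := ya) (u₃ := x) (u₄ := y) (u₅ := z₁)
    (u₆ := z₂) (u₇ := z₃) (u₈ := z₄) (v := yb) (v' := zb) (w₅ := l₂) (w₆ := l₃) ?_ ?_ ?_
  · exact ⟨ca.2.1.symm, ca.1.symm, hy.1, hy.2.1, h₁.adj, h₂.adj, h₃.adj, cb.1, cb.2.1, hl₂.adj,
      hl₃.adj⟩
  · exact ⟨ca.2.2.1, ha.symm, hab, hy.2.2.1.symm, cb.2.2.1.symm, h₁.2.1.ne_of_adj hy.1, hb,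
      hl₂.2.1.ne_of_adj hy.1, n₂.symm, n₃.symm, n₅.symm, n₁.symm, n₄.symm⟩
  · have := h₂.2.1.2
    have := h₃.2.1.2
    have := hl₃.2.1.2
    have := hl₂.2.1.2
    have : ¬ G.Adj y z₄ := fun h => m₁ ⟨hy.1, h, h₃.2.1⟩
    have : ¬ G.Adj l₂ z₄ := fun h => m₂ ⟨hl₂.2.1, h₃.2.1, h⟩
    simp only [List.forall_mem_cons, List.not_mem_nil, false_imp_iff, implies_true, and_true]
    and_intros <;> first | assumption | (rw [SimpleGraph.adj_comm]; assumption)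

theorem Sparse.noStemNine (hG : G.Sparse) {I : Finset V} (hI : ∀ y ∈ I, G.Adj x y) {M : ℕ}
    (hM : 36 * M + 10 ≤ I.card) (hθ : ∀ p q J, G.Theta x p q J → J.card ≤ M)
    (hT : ¬ treeT9.IsIndContained G) : G.NoStemNine x := by
  intro y z₁ z₂ z₃ z₄ z₅ hy h₁ h₂ h₃ h₄ n₁ n₂ n₃ m₀
  by_contra! hcon
  obtain ⟨m₁, m₂⟩ := hcon
  refine hT ?_
  obtain ⟨ya, za, yb, zb, ca, cb, hab, ha, hb, hz, hcross⟩ :=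
    hG.exists_legs_list hI [z₁, z₂, z₃, z₄, z₅] (by
      simp only [List.forall_mem_cons, List.not_mem_nil, false_imp_iff, implies_true, and_true]
      exact ⟨h₁.1, h₁.2.1, h₃.1, h₃.2.1, h₄.2.1⟩) (by simp) y hM hθ
  simp only [List.forall_mem_cons, List.not_mem_nil, false_imp_iff, implies_true, and_true]
    at hcross
  obtain ⟨⟨_, _, _, _⟩, ⟨_, _, _, _⟩, ⟨_, _, _, _⟩, ⟨_, _, _, _⟩, _, _, _, _⟩ := hcross
  refine treeT9_isIndContained hG (u₁ := za) (u₂ := ya) (u₃ := x) (u₄ := y) (u₅ := z₁)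
    (u₆ := z₂) (u₇ := z₃) (u₈ := z₄) (u₉ := z₅) (v := yb) (v' := zb) ?_ ?_ ?_
  · exact ⟨ca.2.1.symm, ca.1.symm, hy.1, hy.2.1, h₁.adj, h₂.adj, h₃.adj, h₄.adj, cb.1, cb.2.1⟩
  · exact ⟨ca.2.2.1, ha.symm, hab, hy.2.2.1.symm, cb.2.2.1.symm, h₁.2.1.ne_of_adj hy.1, hb,
      n₁.symm, n₂.symm, n₃.symm⟩
  · have := h₂.2.1.2
    have := h₃.2.1.2
    have := h₄.2.1.2
    have : ¬ G.Adj y z₄ := fun h => m₀ ⟨hy.1, h, h₃.2.1⟩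
    have : ¬ G.Adj y z₅ := fun h => m₁ ⟨hy.1, h, h₄.2.1⟩
    have : ¬ G.Adj z₁ z₅ := fun h => m₂ ⟨h₁.1, h₄.2.1, h⟩
    simp only [List.forall_mem_cons, List.not_mem_nil, false_imp_iff, implies_true, and_true]
    and_intros <;> first | assumption | (rw [SimpleGraph.adj_comm]; assumption)
end SimpleGraph

/-! ### Large thetas contain the three trees -/

theorem Finset.card_le_of_forall_exists_unique {α : Type*} {n : ℕ} {t : Finset α}
    (P : Fin n → α → Prop) (hP : ∀ i, ∀ a ∈ t, ∀ b ∈ t, P i a → P i b → a = b)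
    (h : ∀ a ∈ t, ∃ i, P i a) : t.card ≤ n := by
  classical
  have hsub : t ⊆ Finset.univ.biUnion fun i => t.filter (P i) := by
    intro a ha
    obtain ⟨i, hi⟩ := h a ha
    exact Finset.mem_biUnion.2 ⟨i, Finset.mem_univ i, Finset.mem_filter.2 ⟨ha, hi⟩⟩
  have h1 := Finset.card_biUnion_le_card_mul Finset.univ (fun i => t.filter (P i)) 1 fun i _ =>
    Finset.card_le_one.2 fun a ha b hb => by
      rw [Finset.mem_filter] at ha hb
      exact hP i a ha.1 b hb.1 ha.2 hb.2
  simpa using (Finset.card_le_card hsub).trans h1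

namespace SimpleGraph

variable {V : Type*} {G : SimpleGraph V} {x p q : V}

/-- The branch at `y` of a theta structure between `x`, `p` and `q`, with additional neighbours `w`
and `w'` of its two inner vertices. -/
structure ThetaBranch (G : SimpleGraph V) (x p q y z z' w w' : V) : Prop where
  child : G.Child x y z
  child' : G.Child x y z'
  ne : z ≠ z'
  adj_p : G.Adj z p
  adj_q : G.Adj z' q
  adj_w : G.FarAdj x z w
  adj_w' : G.FarAdj x z' w'
  w_ne : w ≠ p
  w'_ne : w' ≠ q
  not_y_p : ¬ G.Adj y p
  not_y_q : ¬ G.Adj y q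
  not_z_q : ¬ G.Adj z q
  not_z'_p : ¬ G.Adj z' p

/-- Branches between `x`, `p` and `q` without edges joining them, except possibly edges between
the additional vertices. -/
structure ThetaSystem {ι : Type*} (G : SimpleGraph V) (x p q : V) (y z z' w w' : ι → V) :
    Prop where
  far_p : G.Far x p
  far_q : G.Far x q
  inj : Function.Injective y
  branch : ∀ i, G.ThetaBranch x p q (y i) (z i) (z' i) (w i) (w' i)
  z_z' : ∀ i j, i ≠ j → ¬ G.Adj (z i) (z' j)
  w_y : ∀ i j, i ≠ j → ¬ G.Adj (w i) (y j)
  w_z' : ∀ i j, i ≠ j → ¬ G.Adj (w i) (z' j)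
  w'_y : ∀ i j, i ≠ j → ¬ G.Adj (w' i) (y j)
  w'_z : ∀ i j, i ≠ j → ¬ G.Adj (w' i) (z j)

/-- Four defects of a branch occur at most once each, leaving 220; splitting by adjacency of `w` to
`q` leaves `110 = 10 * (2 * 5 + 1)`. Each of the five unwanted relations sends a branch to at most
one other, so ten independent branches remain. -/
theorem Theta.exists_system [Fintype V] (hG : G.Sparse) {I : Finset V} (h : G.Theta x p q I)
    (hI : 224 ≤ I.card) : ∃ y z z' w w' : Fin 10 → V, G.ThetaSystem x p q y z z' w w' ∧
      ((∀ i, G.Adj (w i) q) ∨ ∀ i, ¬ G.Adj (w i) q) := by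
  classical
  have hb : ∀ y ∈ I, ∃ z z' w w', G.Child x y z ∧ G.Child x y z' ∧ z ≠ z' ∧ G.Adj z p ∧
      G.Adj z' q ∧ G.FarAdj x z w ∧ G.FarAdj x z' w' ∧ w ≠ p ∧ w' ≠ q := by
    intro y hy
    obtain ⟨z, z', h1, h2, h3, h4, h5⟩ := h.legs y hy
    obtain ⟨w, w1, w2, w3⟩ := hG.third z y p
    obtain ⟨w', w4, w5, w6⟩ := hG.third z' y q
    exact ⟨z, z', w, w', h1, h2, h3, h4, h5,
      ⟨h1.2.2, hG.far_of_adj_adj h1.1 h1.2.1 h1.2.2.1 w1 w2, w1⟩,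
      ⟨h2.2.2, hG.far_of_adj_adj h2.1 h2.2.1 h2.2.2.1 w4 w5, w4⟩, w3, w6⟩
  choose! z z' w w' c1 c2 c3 c4 c5 c6 c7 c8 c9 using hb
  set bad : Fin 4 → V → Prop := ![fun y => G.Adj y p, fun y => G.Adj y q, fun y => G.Adj (z y) q,
    fun y => G.Adj (z' y) p] with hbad
  have hbad4 : (I.filter fun y => ∃ i, bad i y).card ≤ 4 := by
    refine Finset.card_le_of_forall_exists_unique bad ?_ fun a ha => (Finset.mem_filter.1 ha).2
    intro i a ha b hb h1 h2
    have ha := (Finset.mem_filter.1 ha).1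
    have hb := (Finset.mem_filter.1 hb).1
    fin_cases i
    · exact hG.child_unique ⟨(c1 a ha).1, h1, h.far_p⟩ ⟨(c1 b hb).1, h2, h.far_p⟩
    · exact hG.child_unique ⟨(c1 a ha).1, h1, h.far_q⟩ ⟨(c1 b hb).1, h2, h.far_q⟩
    · have := hG.common_eq h.ne (c4 a ha).symm h1.symm (c4 b hb).symm h2.symm
      exact hG.child_unique (c1 a ha) (this ▸ c1 b hb)
    · have := hG.common_eq h.ne h1.symm (c5 a ha).symm h2.symm (c5 b hb).symm
      exact hG.child_unique (c2 a ha) (this ▸ c2 b hb)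
  have branch : ∀ y ∈ I.filter fun y => ¬ ∃ i, bad i y,
      G.ThetaBranch x p q y (z y) (z' y) (w y) (w' y) := by
    intro y hy
    obtain ⟨hy, hnb⟩ := Finset.mem_filter.1 hy
    push Not at hnb
    exact ⟨c1 y hy, c2 y hy, c3 y hy, c4 y hy, c5 y hy, c6 y hy, c7 y hy, c8 y hy, c9 y hy,
      hnb 0, hnb 1, hnb 2, hnb 3⟩
  obtain ⟨J, hJ, hJcard, hJq⟩ : ∃ J : Finset V,
      (∀ y ∈ J, G.ThetaBranch x p q y (z y) (z' y) (w y) (w' y)) ∧ 10 * (2 * 5 + 1) ≤ J.card ∧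
      ((∀ y ∈ J, G.Adj (w y) q) ∨ ∀ y ∈ J, ¬ G.Adj (w y) q) := by
    have h1 := I.card_filter_add_card_filter_not fun y => ∃ i, bad i y
    have h2 := (I.filter fun y => ¬ ∃ i, bad i y).card_filter_add_card_filter_not
      fun y => G.Adj (w y) q
    rcases le_total 110 ((I.filter fun y => ¬ ∃ i, bad i y).filter fun y => G.Adj (w y) q).card
      with h3 | h3
    · exact ⟨_, fun y hy => branch y (Finset.mem_filter.1 hy).1, h3,
        .inl fun y hy => (Finset.mem_filter.1 hy).2⟩
    · exact ⟨(I.filter fun y => ¬ ∃ i, bad i y).filter fun y => ¬ G.Adj (w y) q,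
        fun y hy => branch y (Finset.mem_filter.1 hy).1, by omega,
        .inr fun y hy => (Finset.mem_filter.1 hy).2⟩
  set R : Fin 5 → V → V → Prop := ![fun a b => G.Adj (z a) (z' b), fun a b => G.Adj (w a) b,
    fun a b => G.Adj (w a) (z' b), fun a b => G.Adj (w' a) b, fun a b => G.Adj (w' a) (z b)]
    with hR
  obtain ⟨f, hf, hfJ, hfR⟩ := Finset.exists_injective_pairwise_not_rel
    (fun a b => ∃ i, R i a b) 5 10 J (fun a ha t ht htR => by
      refine Finset.card_le_of_forall_exists_unique (fun i => R i a) ?_ htR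
      intro i b hb c hc h1 h2
      have ga := hJ a ha
      have gb := hJ b (ht hb)
      have gc := hJ c (ht hc)
      have heq' : z' b = z' c → b = c := fun h => hG.child_unique gb.child' (h ▸ gc.child')
      have heq : z b = z c → b = c := fun h => hG.child_unique gb.child (h ▸ gc.child)
      fin_cases i
      · refine heq' (hG.common_eq ?_ h1 gb.adj_q.symm h2 gc.adj_q.symm)
        rintro h
        exact ga.not_y_q (h ▸ ga.child.2.1)
      · exact hG.child_unique ⟨gb.child.1, h1.symm, ga.adj_w.2.1⟩ ⟨gc.child.1, h2.symm, ga.adj_w.2.1⟩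
      · refine heq' (hG.common_eq ?_ h1 gb.adj_q.symm h2 gc.adj_q.symm)
        rintro h
        exact ga.not_z_q (h ▸ ga.adj_w.adj)
      · exact hG.child_unique ⟨gb.child.1, h1.symm, ga.adj_w'.2.1⟩
          ⟨gc.child.1, h2.symm, ga.adj_w'.2.1⟩
      · refine heq (hG.common_eq ?_ h1 gb.adj_p.symm h2 gc.adj_p.symm)
        rintro h
        exact ga.not_z'_p (h ▸ ga.adj_w'.adj)) hJcard
  have hR' : ∀ i j k, i ≠ j → ¬ R k (f i) (f j) := fun i j k hij h => hfR i j hij ⟨k, h⟩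
  exact ⟨f, z ∘ f, z' ∘ f, w ∘ f, w' ∘ f, ⟨h.far_p, h.far_q, hf, fun i => hJ _ (hfJ i),
    fun i j hij => hR' i j 0 hij, fun i j hij => hR' i j 1 hij, fun i j hij => hR' i j 2 hij,
    fun i j hij => hR' i j 3 hij, fun i j hij => hR' i j 4 hij⟩,
    hJq.imp (fun h i => h _ (hfJ i)) (fun h i => h _ (hfJ i))⟩

namespace ThetaSystem

variable {ι : Type*} {y z z' w w' : ι → V}

/-- All the pairs of vertices of a theta system that are known not to be adjacent. -/
theorem not_adj (hG : G.Sparse) (h : G.ThetaSystem x p q y z z' w w') {i j : ι} (hij : i ≠ j) :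
    ¬ G.Adj (y i) (z j) ∧ ¬ G.Adj (y i) (z' j) ∧ ¬ G.Adj (y i) (w j) ∧ ¬ G.Adj (y i) (w' j) ∧
    ¬ G.Adj (z i) (z j) ∧ ¬ G.Adj (z i) (z' j) ∧ ¬ G.Adj (z i) (w j) ∧ ¬ G.Adj (z i) (w' j) ∧
    ¬ G.Adj (z' i) (z' j) ∧ ¬ G.Adj (z' i) (w j) ∧ ¬ G.Adj (z' i) (w' j) := by
  have bi := h.branch i
  have bj := h.branch j
  have hy : ¬ y i = y j := fun e => hij (h.inj e)
  refine ⟨fun e => hy (hG.child_unique ⟨bi.child.1, e, bj.child.2.2⟩ bj.child),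
    fun e => hy (hG.child_unique ⟨bi.child.1, e, bj.child'.2.2⟩ bj.child'),
    fun e => h.w_y j i hij.symm e.symm, fun e => h.w'_y j i hij.symm e.symm,
    fun e => hG.tri e bj.adj_p bi.adj_p, h.z_z' i j hij, fun e => ?_,
    fun e => h.w'_z j i hij.symm e.symm, fun e => hG.tri e bj.adj_q bi.adj_q,
    fun e => h.w_z' j i hij.symm e.symm, fun e => ?_⟩
  · have := hG.common_eq bj.w_ne e.symm bi.adj_p.symm bj.adj_w.adj.symm bj.adj_p.symm
    exact hy (hG.child_unique bi.child (this ▸ bj.child))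
  · have := hG.common_eq bj.w'_ne e.symm bi.adj_q.symm bj.adj_w'.adj.symm bj.adj_q.symm
    exact hy (hG.child_unique bi.child' (this ▸ bj.child'))

theorem comp (h : G.ThetaSystem x p q y z z' w w') {κ : Type*} {σ : κ → ι}
    (hσ : Function.Injective σ) :
    G.ThetaSystem x p q (y ∘ σ) (z ∘ σ) (z' ∘ σ) (w ∘ σ) (w' ∘ σ) :=
  ⟨h.far_p, h.far_q, h.inj.comp hσ, fun i => h.branch (σ i),
    fun _ _ hij => h.z_z' _ _ (hσ.ne hij), fun _ _ hij => h.w_y _ _ (hσ.ne hij),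
    fun _ _ hij => h.w_z' _ _ (hσ.ne hij), fun _ _ hij => h.w'_y _ _ (hσ.ne hij),
    fun _ _ hij => h.w'_z _ _ (hσ.ne hij)⟩

/-- The centre is `x`. The path leaves through `y 0` and `z' 0` to `q` and returns into another
branch. -/
theorem treeT82_isIndContained (hG : G.Sparse) {y z z' w w' : Fin 4 → V}
    (h : G.ThetaSystem x p q y z z' w w') :
    treeT82.IsIndContained G := by
  have b := h.branch
  have n : ∀ i j, i ≠ j → y i ≠ y j := fun i j hij => h.inj.ne hij
  have h1 := fun i => (b i).not_y_q
  have h2 := fun i => (b i).not_z_q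
  have h3 := fun i => (b i).child'.2.2.2
  have h4 := fun i => (b i).adj_w'.2.1.2
  have n_yzp := fun i j hij => (h.not_adj hG (i := i) (j := j) hij).2.1
  have n_ywp := fun i j hij => (h.not_adj hG (i := i) (j := j) hij).2.2.2.1
  have n_zz := fun i j hij => (h.not_adj hG (i := i) (j := j) hij).2.2.2.2.1
  have n_zzp := fun i j hij => (h.not_adj hG (i := i) (j := j) hij).2.2.2.2.2.1
  have n_zwp := fun i j hij => (h.not_adj hG (i := i) (j := j) hij).2.2.2.2.2.2.2.1
  refine SimpleGraph.treeT82_isIndContained hG (u₁ := z 2) (u₂ := y 2) (u₃ := x) (u₄ := y 0)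
    (u₅ := z' 0) (u₆ := q) (u₇ := z' 1) (u₈ := w' 1) (v := y 3) (v' := z 3) (w := z 0) ?_ ?_ ?_
  · exact ⟨(b 2).child.2.1.symm, (b 2).child.1.symm, (b 0).child.1, (b 0).child'.2.1, (b 0).adj_q,
      (b 1).adj_q.symm, (b 1).adj_w'.adj, (b 3).child.1, (b 3).child.2.1, (b 0).child.2.1⟩
  · refine ⟨(b 2).child.2.2.1, n _ _ (by decide), n _ _ (by decide), (b 0).child'.2.2.1.symm,
      (b 3).child.2.2.1.symm, (b 0).child.2.2.1.symm, h.far_q.ne_of_adj (b 0).child.1,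
      n _ _ (by decide), fun e => ?_, (b 0).ne.symm, (b 1).w'_ne.symm⟩
    exact n 0 1 (by decide) (hG.child_unique (b 0).child' (e ▸ (b 1).child'))
  · simp only [List.forall_mem_cons, List.not_mem_nil, false_imp_iff, implies_true, and_true]
    and_intros <;> first
      | exact h1 _
      | exact fun e => h1 _ e.symm
      | exact h2 _
      | exact fun e => h2 _ e.symm
      | exact h3 _
      | exact fun e => h3 _ e.symm
      | exact h4 _
      | exact fun e => h4 _ e.symm
      | (refine n_yzp _ _ ?_; decide)
      | (refine fun e => n_yzp _ _ ?_ e.symm; decide)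
      | (refine n_ywp _ _ ?_; decide)
      | (refine fun e => n_ywp _ _ ?_ e.symm; decide)
      | (refine n_zz _ _ ?_; decide)
      | (refine n_zzp _ _ ?_; decide)
      | (refine fun e => n_zzp _ _ ?_ e.symm; decide)
      | (refine n_zwp _ _ ?_; decide)
      | (refine fun e => n_zwp _ _ ?_ e.symm; decide)

theorem treeT81_isIndContained (hG : G.Sparse) {y z z' w w' : Fin 5 → V}
    (h : G.ThetaSystem x p q y z z' w w') (hw : ¬ G.Adj (w' 0) (w' 1)) :
    treeT81.IsIndContained G := by
  have b := h.branch
  have n : ∀ i j, i ≠ j → y i ≠ y j := fun i j hij => h.inj.ne hij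
  have h1 := fun i => (b i).not_y_q
  have h2 := fun i => (b i).not_z_q
  have h3 := fun i => (b i).child'.2.2.2
  have h4 := fun i => (b i).adj_w'.2.1.2
  have n_yzp := fun i j hij => (h.not_adj hG (i := i) (j := j) hij).2.1
  have n_ywp := fun i j hij => (h.not_adj hG (i := i) (j := j) hij).2.2.2.1
  have n_zz := fun i j hij => (h.not_adj hG (i := i) (j := j) hij).2.2.2.2.1
  have n_zzp := fun i j hij => (h.not_adj hG (i := i) (j := j) hij).2.2.2.2.2.1
  have n_zwp := fun i j hij => (h.not_adj hG (i := i) (j := j) hij).2.2.2.2.2.2.2.1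
  refine SimpleGraph.treeT81_isIndContained hG (u₁ := z 2) (u₂ := y 2) (u₃ := x) (u₄ := y 0)
    (u₅ := z' 0) (u₆ := q) (u₇ := z' 1) (u₈ := w' 1) (v := y 3) (v' := z 3) (w₅ := w' 0) (w₆ := z' 4) ?_ ?_ ?_
  · exact ⟨(b 2).child.2.1.symm, (b 2).child.1.symm, (b 0).child.1, (b 0).child'.2.1, (b 0).adj_q,
      (b 1).adj_q.symm, (b 1).adj_w'.adj, (b 3).child.1, (b 3).child.2.1, (b 0).adj_w'.adj,
      (b 4).adj_q.symm⟩
  · have hz : ∀ i j, i ≠ j → z' i ≠ z' j := fun i j hij e =>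
      n i j hij (hG.child_unique (b i).child' (e ▸ (b j).child'))
    exact ⟨(b 2).child.2.2.1, n _ _ (by decide), n _ _ (by decide), (b 0).child'.2.2.1.symm,
      (b 3).child.2.2.1.symm, h.far_q.ne_of_adj (b 0).child.1, n _ _ (by decide),
      (b 0).adj_w'.2.1.ne_of_adj (b 0).child.1, hz _ _ (by decide), hz _ _ (by decide),
      (b 1).w'_ne.symm, (b 0).w'_ne.symm, hz _ _ (by decide)⟩
  · simp only [List.forall_mem_cons, List.not_mem_nil, false_imp_iff, implies_true, and_true]
    and_intros <;> first
      | assumption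
      | (rw [SimpleGraph.adj_comm]; assumption)
      | exact h1 _
      | exact fun e => h1 _ e.symm
      | exact h2 _
      | exact fun e => h2 _ e.symm
      | exact h3 _
      | exact fun e => h3 _ e.symm
      | exact h4 _
      | exact fun e => h4 _ e.symm
      | (refine n_yzp _ _ ?_; decide)
      | (refine fun e => n_yzp _ _ ?_ e.symm; decide)
      | (refine n_ywp _ _ ?_; decide)
      | (refine fun e => n_ywp _ _ ?_ e.symm; decide)
      | (refine n_zz _ _ ?_; decide)
      | (refine n_zzp _ _ ?_; decide)
      | (refine fun e => n_zzp _ _ ?_ e.symm; decide)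
      | (refine n_zwp _ _ ?_; decide)
      | (refine fun e => n_zwp _ _ ?_ e.symm; decide)

/-- The detour `z 0`, `w 0` replaces `z' 0` on the way from `y 0` to `q`, which makes the path one
vertex longer. -/
theorem treeT9_isIndContained_of_adj (hG : G.Sparse) {y z z' w w' : Fin 4 → V}
    (h : G.ThetaSystem x p q y z z' w w') (hq : G.Adj (w 0) q) :
    treeT9.IsIndContained G := by
  have b := h.branch
  have n : ∀ i j, i ≠ j → y i ≠ y j := fun i j hij => h.inj.ne hij
  have h1 := fun i => (b i).not_y_q
  have h2 := fun i => (b i).not_z_q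
  have h3 := fun i => (b i).child'.2.2.2
  have h4 := fun i => (b i).adj_w'.2.1.2
  have h5 := fun i => (b i).child.2.2.2
  have h6 := fun i => (b i).adj_w.2.1.2
  have h7 := h.far_q.2
  have n_yzp := fun i j hij => (h.not_adj hG (i := i) (j := j) hij).2.1
  have n_ywp := fun i j hij => (h.not_adj hG (i := i) (j := j) hij).2.2.2.1
  have n_yw := fun i j hij => (h.not_adj hG (i := i) (j := j) hij).2.2.1
  have n_zz := fun i j hij => (h.not_adj hG (i := i) (j := j) hij).2.2.2.2.1
  have n_zzp := fun i j hij => (h.not_adj hG (i := i) (j := j) hij).2.2.2.2.2.1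
  have n_zwp := fun i j hij => (h.not_adj hG (i := i) (j := j) hij).2.2.2.2.2.2.2.1
  have n_zw := fun i j hij => (h.not_adj hG (i := i) (j := j) hij).2.2.2.2.2.2.1
  refine SimpleGraph.treeT9_isIndContained hG (u₁ := z 2) (u₂ := y 2) (u₃ := x) (u₄ := y 0)
    (u₅ := z 0) (u₆ := w 0) (u₇ := q) (u₈ := z' 1) (u₉ := w' 1) (v := y 3) (v' := z 3) ?_ ?_ ?_
  · exact ⟨(b 2).child.2.1.symm, (b 2).child.1.symm, (b 0).child.1, (b 0).child.2.1, (b 0).adj_w.adj,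
      hq, (b 1).adj_q.symm, (b 1).adj_w'.adj, (b 3).child.1, (b 3).child.2.1⟩
  · refine ⟨(b 2).child.2.2.1, n _ _ (by decide), n _ _ (by decide), (b 0).child.2.2.1.symm,
      (b 3).child.2.2.1.symm, (b 0).adj_w.2.1.ne_of_adj (b 0).child.1,
      n _ _ (by decide), ?_, ?_, (b 1).w'_ne.symm⟩
    · rintro e
      exact (b 0).not_y_q (e ▸ (b 0).child.2.1)
    · rintro e
      exact h.z_z' 0 1 (by decide) (e ▸ (b 0).adj_w.adj)
  · simp only [List.forall_mem_cons, List.not_mem_nil, false_imp_iff, implies_true, and_true]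
    and_intros <;> first
      | assumption
      | exact h1 _
      | exact fun e => h1 _ e.symm
      | exact h2 _
      | exact fun e => h2 _ e.symm
      | exact h3 _
      | exact fun e => h3 _ e.symm
      | exact h4 _
      | exact fun e => h4 _ e.symm
      | exact h5 _
      | exact fun e => h5 _ e.symm
      | exact h6 _
      | exact fun e => h6 _ e.symm
      | exact h7
      | exact fun e => h7 e.symm
      | (refine n_yzp _ _ ?_; decide)
      | (refine fun e => n_yzp _ _ ?_ e.symm; decide)
      | (refine n_ywp _ _ ?_; decide)
      | (refine fun e => n_ywp _ _ ?_ e.symm; decide)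
      | (refine n_yw _ _ ?_; decide)
      | (refine fun e => n_yw _ _ ?_ e.symm; decide)
      | (refine n_zz _ _ ?_; decide)
      | (refine n_zzp _ _ ?_; decide)
      | (refine fun e => n_zzp _ _ ?_ e.symm; decide)
      | (refine n_zwp _ _ ?_; decide)
      | (refine fun e => n_zwp _ _ ?_ e.symm; decide)
      | (refine n_zw _ _ ?_; decide)
      | (refine fun e => n_zw _ _ ?_ e.symm; decide)

/-- Here the centre is `q`, with two legs `z' w'`, and the path runs through `x` into branch 3. -/
theorem treeT9_isIndContained_of_not_adj (hG : G.Sparse) {y z z' w w' : Fin 4 → V}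
    (h : G.ThetaSystem x p q y z z' w w') (hq : ¬ G.Adj (w 3) q) (h₁ : ¬ G.Adj (w' 0) (w' 1))
    (h₂ : ¬ G.Adj (w 3) (w' 0)) (h₃ : ¬ G.Adj (w 3) (w' 1)) :
    treeT9.IsIndContained G := by
  have b := h.branch
  have n : ∀ i j, i ≠ j → y i ≠ y j := fun i j hij => h.inj.ne hij
  have h1 := fun i => (b i).not_y_q
  have h2 := fun i => (b i).not_z_q
  have h3 := fun i => (b i).child'.2.2.2
  have h4 := fun i => (b i).adj_w'.2.1.2
  have h5 := fun i => (b i).child.2.2.2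
  have h6 := fun i => (b i).adj_w.2.1.2
  have h7 := h.far_q.2
  have n_yzp := fun i j hij => (h.not_adj hG (i := i) (j := j) hij).2.1
  have n_ywp := fun i j hij => (h.not_adj hG (i := i) (j := j) hij).2.2.2.1
  have n_yw := fun i j hij => (h.not_adj hG (i := i) (j := j) hij).2.2.1
  have n_zzp := fun i j hij => (h.not_adj hG (i := i) (j := j) hij).2.2.2.2.2.1
  have n_zwp := fun i j hij => (h.not_adj hG (i := i) (j := j) hij).2.2.2.2.2.2.2.1
  have n_zpw := fun i j hij => (h.not_adj hG (i := i) (j := j) hij).2.2.2.2.2.2.2.2.2.1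
  refine SimpleGraph.treeT9_isIndContained hG (u₁ := w' 0) (u₂ := z' 0) (u₃ := q) (u₄ := z' 2)
    (u₅ := y 2) (u₆ := x) (u₇ := y 3) (u₈ := z 3) (u₉ := w 3) (v := z' 1) (v' := w' 1) ?_ ?_ ?_
  · exact ⟨(b 0).adj_w'.adj.symm, (b 0).adj_q, (b 2).adj_q.symm, (b 2).child'.2.1.symm,
      (b 2).child.1.symm, (b 3).child.1, (b 3).child.2.1, (b 3).adj_w.adj, (b 1).adj_q.symm,
      (b 1).adj_w'.adj⟩
  · have hz : ∀ i j, i ≠ j → z' i ≠ z' j := fun i j hij e =>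
      n i j hij (hG.child_unique (b i).child' (e ▸ (b j).child'))
    exact ⟨(b 0).w'_ne, hz _ _ (by decide), hz _ _ (by decide),
      (h.far_q.ne_of_adj (b 2).child.1).symm, (b 1).w'_ne.symm, (b 2).child'.2.2.1,
      hz _ _ (by decide), n _ _ (by decide), (b 3).child.2.2.1.symm,
      (b 3).adj_w.2.1.ne_of_adj (b 3).child.1⟩
  · simp only [List.forall_mem_cons, List.not_mem_nil, false_imp_iff, implies_true, and_true]
    and_intros <;> first
      | assumption
      | (rw [SimpleGraph.adj_comm]; assumption)
      | exact h1 _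
      | exact fun e => h1 _ e.symm
      | exact h2 _
      | exact fun e => h2 _ e.symm
      | exact h3 _
      | exact fun e => h3 _ e.symm
      | exact h4 _
      | exact fun e => h4 _ e.symm
      | exact h5 _
      | exact fun e => h5 _ e.symm
      | exact h6 _
      | exact fun e => h6 _ e.symm
      | exact h7
      | exact fun e => h7 e.symm
      | (refine n_yzp _ _ ?_; decide)
      | (refine fun e => n_yzp _ _ ?_ e.symm; decide)
      | (refine n_ywp _ _ ?_; decide)
      | (refine fun e => n_ywp _ _ ?_ e.symm; decide)
      | (refine n_yw _ _ ?_; decide)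
      | (refine n_zzp _ _ ?_; decide)
      | (refine fun e => n_zzp _ _ ?_ e.symm; decide)
      | (refine n_zwp _ _ ?_; decide)
      | (refine fun e => n_zwp _ _ ?_ e.symm; decide)
      | (refine n_zpw _ _ ?_; decide)
      | (refine fun e => n_zpw _ _ ?_ e.symm; decide)

end ThetaSystem
end SimpleGraph

/-! ### Choice of branches and conclusion -/

namespace SimpleGraph

variable {V : Type*} {G : SimpleGraph V} {x p q : V}

/-- Among three of the vertices `w'` two are non-adjacent, as there is no triangle. -/
theorem ThetaSystem.treeT81_isIndContained_of_fin_ten (hG : G.Sparse) {y z z' w w' : Fin 10 → V}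
    (h : G.ThetaSystem x p q y z z' w w') : treeT81.IsIndContained G := by
  have key : ∀ σ : Fin 5 → Fin 10, Function.Injective σ → ¬ G.Adj (w' (σ 0)) (w' (σ 1)) →
      treeT81.IsIndContained G := fun σ hσ hw => (h.comp hσ).treeT81_isIndContained hG hw
  by_cases h01 : G.Adj (w' 0) (w' 1)
  · by_cases h02 : G.Adj (w' 0) (w' 2)
    · exact key ![1, 2, 3, 4, 5] (by decide) (hG.tri h01.symm h02)
    · exact key ![0, 2, 3, 4, 5] (by decide) h02
  · exact key ![0, 1, 3, 4, 5] (by decide) h01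

/-- Branch 9 links `q` to `x`, and `w d` with `d` in `{0, 1}` ends the path. If `w d` misses three
of the seven vertices `w' 2, …, w' 8`, two of these are non-adjacent and give the legs. Otherwise `w
0` and `w 1` each miss at most two, so they have three common neighbours, while the girth allows
one. -/
theorem ThetaSystem.treeT9_isIndContained_of_fin_ten (hG : G.Sparse) {y z z' w w' : Fin 10 → V}
    (h : G.ThetaSystem x p q y z z' w w') (hq : ∀ i, ¬ G.Adj (w i) q) :
    treeT9.IsIndContained G := by
  classical
  have b := h.branch
  have hw : w 0 ≠ w 1 := by
    intro e
    have := hG.common_eq (b 0).w_ne (b 0).adj_w.adj.symm (b 0).adj_p.symm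
      (e ▸ (b 1).adj_w.adj.symm) (b 1).adj_p.symm
    exact h.inj.ne (show (0 : Fin 10) ≠ 1 by decide)
      (hG.child_unique (b 0).child (this ▸ (b 1).child))
  have hw' : ∀ i j, w' i = w' j → i = j := by
    intro i j e
    have := hG.common_eq (b i).w'_ne (b i).adj_w'.adj.symm (b i).adj_q.symm
      (e ▸ (b j).adj_w'.adj.symm) (b j).adj_q.symm
    exact h.inj (hG.child_unique (b i).child' (this ▸ (b j).child'))
  have key : ∀ i j d, i ≠ j → i ≠ 9 → j ≠ 9 → d ≠ 9 → i ≠ d → j ≠ d → ¬ G.Adj (w' i) (w' j) →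
      ¬ G.Adj (w d) (w' i) → ¬ G.Adj (w d) (w' j) → treeT9.IsIndContained G := by
    intro i j d h1 h2 h3 h4 h5 h6 m1 m2 m3
    have hσ : Function.Injective (![i, j, 9, d] : Fin 4 → Fin 10) := by
      intro a b hab
      fin_cases a <;> fin_cases b <;> simp_all
    exact (h.comp hσ).treeT9_isIndContained_of_not_adj hG (hq d) m1 m2 m3
  set s : Finset (Fin 10) := {2, 3, 4, 5, 6, 7, 8} with hs
  have hs' : ∀ i ∈ s, i ≠ 9 ∧ i ≠ 0 ∧ i ≠ 1 := by decide
  have three : ∀ d, (d = 0 ∨ d = 1) → 2 < (s.filter fun i => ¬ G.Adj (w d) (w' i)).card →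
      treeT9.IsIndContained G := by
    intro d hd hc
    obtain ⟨i, hi, j, hj, k, hk, hij, hik, hjk⟩ := Finset.two_lt_card.1 hc
    rw [Finset.mem_filter] at hi hj hk
    have hd9 : d ≠ 9 := by rcases hd with rfl | rfl <;> decide
    have hsd : ∀ i ∈ s, i ≠ d := by
      rcases hd with rfl | rfl
      exacts [fun i hi => (hs' i hi).2.1, fun i hi => (hs' i hi).2.2]
    have h9 : ∀ i ∈ s, i ≠ 9 := fun i hi => (hs' i hi).1
    by_cases h1 : G.Adj (w' i) (w' j)
    · by_cases h2 : G.Adj (w' i) (w' k)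
      · exact key j k d hjk (h9 _ hj.1) (h9 _ hk.1) hd9 (hsd _ hj.1) (hsd _ hk.1)
          (hG.tri h1.symm h2) hj.2 hk.2
      · exact key i k d hik (h9 _ hi.1) (h9 _ hk.1) hd9 (hsd _ hi.1) (hsd _ hk.1) h2 hi.2 hk.2
    · exact key i j d hij (h9 _ hi.1) (h9 _ hj.1) hd9 (hsd _ hi.1) (hsd _ hj.1) h1 hi.2 hj.2
  by_contra hcon
  have h0 : ¬ 2 < _ := fun hc => hcon (three 0 (.inl rfl) hc)
  have h1 : ¬ 2 < _ := fun hc => hcon (three 1 (.inr rfl) hc)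
  have hboth : (s.filter fun i => G.Adj (w 0) (w' i) ∧ G.Adj (w 1) (w' i)).card ≤ 1 :=
    Finset.card_le_one.2 fun i hi j hj => by
      rw [Finset.mem_filter] at hi hj
      exact hw' i j (hG.common_eq hw hi.2.1 hi.2.2 hj.2.1 hj.2.2)
  have hsub : s ⊆ (s.filter fun i => ¬ G.Adj (w 0) (w' i)) ∪
      ((s.filter fun i => ¬ G.Adj (w 1) (w' i)) ∪
        s.filter fun i => G.Adj (w 0) (w' i) ∧ G.Adj (w 1) (w' i)) := by
    intro i hi
    simp only [Finset.mem_union, Finset.mem_filter]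
    tauto
  have e1 := Finset.card_le_card hsub
  have e2 := Finset.card_union_le (s.filter fun i => ¬ G.Adj (w 0) (w' i))
    ((s.filter fun i => ¬ G.Adj (w 1) (w' i)) ∪
        s.filter fun i => G.Adj (w 0) (w' i) ∧ G.Adj (w 1) (w' i))
  have e3 := Finset.card_union_le (s.filter fun i => ¬ G.Adj (w 1) (w' i))
    (s.filter fun i => G.Adj (w 0) (w' i) ∧ G.Adj (w 1) (w' i))
  have e4 : s.card = 7 := by decide
  omega

theorem Theta.isIndContained [Fintype V] (hG : G.Sparse) {I : Finset V} (h : G.Theta x p q I)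
    (hI : 224 ≤ I.card) :
    treeT81.IsIndContained G ∧ treeT82.IsIndContained G ∧ treeT9.IsIndContained G := by
  obtain ⟨y, z, z', w, w', hs, hq⟩ := h.exists_system hG hI
  have hσ : Function.Injective (Fin.castLE (show 4 ≤ 10 by decide)) := Fin.castLE_injective _
  refine ⟨hs.treeT81_isIndContained_of_fin_ten hG, (hs.comp hσ).treeT82_isIndContained hG, ?_⟩
  rcases hq with hq | hq
  · exact (hs.comp hσ).treeT9_isIndContained_of_adj hG (hq _)
  · exact hs.treeT9_isIndContained_of_fin_ten hG hq

/-- The three trees are induced subgraphs of every graph of girth at least five and minimum degree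
at least three that has a vertex of sufficiently large degree. -/
theorem Sparse.isIndContained [Fintype V] (hG : G.Sparse) {I : Finset V}
    (hI : ∀ y ∈ I, G.Adj x y) (hIcard : 8074 ≤ I.card) :
    treeT81.IsIndContained G ∧ treeT82.IsIndContained G ∧ treeT9.IsIndContained G := by
  by_cases hθ : ∀ p q J, G.Theta x p q J → J.card ≤ 224
  · refine ⟨?_, ?_, ?_⟩ <;> by_contra hT
    · exact hT (((hG.noStemOne hI (by omega) hθ hT).tame hG).isIndContained hG hI (by omega)).1
    · exact hT (((hG.noStemTwo hI (by omega) hθ hT).tame hG).isIndContained hG hI (by omega)).2.1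
    · exact hT (((hG.noStemNine hI (by omega) hθ hT).tame hG).isIndContained hG hI (by omega)).2.2
  · push Not at hθ
    obtain ⟨p, q, J, hJ, hcard⟩ := hθ
    exact hJ.isIndContained hG hcard.le

theorem sparse_of_not_isIndContained [Fintype V] [DecidableRel G.Adj]
    (hC3 : ¬ (cycleGraph 3).IsIndContained G) (hC4 : ¬ (cycleGraph 4).IsIndContained G)
    (hδ : 3 ≤ G.minDegree) : G.Sparse := by
  have tri : ∀ {a b c}, G.Adj a b → G.Adj b c → ¬ G.Adj a c := by
    intro a b c hab hbc hac
    refine hC3 (isIndContained_of_map ![a, b, c] (by decide) fun i j hij => ?_)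
    fin_cases i <;> fin_cases j <;>
      first
      | exact absurd hij (by decide)
      | exact iff_of_true (by decide) (by assumption)
  refine ⟨tri, ?_, ?_⟩
  · intro a b c d hab hbc hcd hac hbd had
    refine hC4 ?_
    have hac' : ¬ G.Adj a c := tri hab hbc
    have hbd' : ¬ G.Adj b d := tri hbc hcd
    refine ⟨⟨⟨![a, b, c, d], ?_⟩, ?_⟩⟩
    · intro i j hij
      fin_cases i <;> fin_cases j <;>
        first
        | rfl
        | exact absurd hij hab.ne
        | exact absurd hij hab.ne'
        | exact absurd hij hbc.ne
        | exact absurd hij hbc.ne'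
        | exact absurd hij hcd.ne
        | exact absurd hij hcd.ne'
        | exact absurd hij had.ne
        | exact absurd hij had.ne'
        | exact absurd hij hac
        | exact absurd hij hac.symm
        | exact absurd hij hbd
        | exact absurd hij hbd.symm
    · intro i j
      have h1 := hab.symm
      have h2 := hbc.symm
      have h3 := hcd.symm
      have h4 := had.symm
      have h5 : ¬ G.Adj c a := fun h => hac' h.symm
      have h6 : ¬ G.Adj d b := fun h => hbd' h.symm
      fin_cases i <;> fin_cases j <;>
        first
        | exact iff_of_true (by assumption) (by decide)
        | exact iff_of_false (by assumption) (by decide)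
        | exact iff_of_false (G.irrefl) (by decide)
  · intro v a b
    classical
    by_contra! hcon
    have hsub : G.neighborFinset v ⊆ {a, b} := by
      intro c hc
      rw [mem_neighborFinset] at hc
      by_cases hca : c = a
      · simp [hca]
      · simp [hcon c hc hca]
    have h1 := (Finset.card_le_card hsub).trans Finset.card_le_two
    have h2 := G.minDegree_le_degree v
    rw [card_neighborFinset_eq_degree] at h1
    omega

end SimpleGraph

theorem theorem4 {V : Type*} [Fintype V] (G : SimpleGraph V) [DecidableRel G.Adj]
    (hconn : G.Connected)
    (hC3 : ¬ (SimpleGraph.cycleGraph 3).IsIndContained G)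
    (hC4 : ¬ (SimpleGraph.cycleGraph 4).IsIndContained G)
    (hδ : 3 ≤ G.minDegree) :
    (943218 ≤ G.maxDegree → treeT81.IsIndContained G) ∧
    (190375 ≤ G.maxDegree → treeT82.IsIndContained G) ∧
    (197433 ≤ G.maxDegree → treeT9.IsIndContained G) := by
  have := hconn.nonempty
  obtain ⟨x, hx⟩ := G.exists_maximal_degree_vertex
  have hG := SimpleGraph.sparse_of_not_isIndContained hC3 hC4 hδ
  have key : 8074 ≤ G.maxDegree → _ := fun h => hG.isIndContained (I := G.neighborFinset x)
    (fun y hy => (G.mem_neighborFinset x y).1 hy)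
    (by rwa [G.card_neighborFinset_eq_degree, ← hx])
  exact ⟨fun h => (key (by omega)).1, fun h => (key (by omega)).2.1, fun h => (key (by omega)).2.2⟩
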